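/- All spaces are well-pointed compactly generated Hausdorff spaces; maps and homotopies are pointed, products are taken in compactly generated spaces, and homotopy pullbacks, pushouts and cofibres are the pointed ones, defined up to homotopy equivalence. For a space $B$ let $B^{[n+1]}$ be the $(n+1)$-fold smash product, i.e. $B^{n+1}$ with the fat wedge $\{(b_0,\dots,b_n) : b_i=* \text{ for some } i\}$ collapsed to a point. The weak category $\mathrm{wcat}(B)\in\mathbb N\cup\{\infty\}$ is the least $n\ge 0$ such that the reduced diagonal $B\to B^{n+1}\to B^{[n+1]}$ is homotopically trivial ($\infty$ if there is no such $n$). The join of $f:X\to Z$ and $g:Y\to Z$ is the canonical map $X*_ZY\to Z$ from the homotopy pushout of the projections of the homotopy pullback of $f$ and $g$. For a map $p:E\to B$ define $\kappa_n:T^n(p)\to B^{n+1}$ by $\kappa_0=p$ and, for $n\ge1$, $\kappa_n$ is the join of $\kappa_{n-1}\times \mathrm{id}_B$ and $\mathrm{id}_{B^n}\times p$. The weak sectional category $\mathrm{wsecat}(p)\in\mathbb N\cup\{\infty\}$ is the least $n\ge 0$ such that the composite $B\xrightarrow{\Delta_{n+1}}B^{n+1}\to C_{\kappa_n}$ of the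 diagonal with the canonical map to the homotopy cofibre of $\kappa_n$ is homotopically trivial ($\infty$ if there is no such $n$). **Theorem.** 1. Consider any homotopy commutative diagram $$\begin{array}{ccccc} B' & \xleftarrow{\ g'\ } & A' & \xrightarrow{\ f'\ } & C'\\ {\scriptstyle\beta}\downarrow & & {\scriptstyle\alpha}\downarrow & & \downarrow{\scriptstyle\gamma}\\ B & \xleftarrow{\ g\ } & A & \xrightarrow{\ f\ } & C\end{array}$$ with chosen homotopies $\beta g'\simeq g\alpha$ and $f\alpha\simeq\gamma f'$. Let $D'$ and $D$ be homotopy pushouts of the top and bottom rows and let $\delta:D'\to D$ be the induced map. Then $$\mathrm{wsecat}(\delta)\le \mathrm{wsecat}(\beta)+\mathrm{wsecat}(\gamma)+1.$$ 2. In particular, if $D$ is a homotopy pushout of $B\xleftarrow{g}A\xrightarrow{f}C$, then $\mathrm{wcat}(D)\le\mathrm{wcat}(B)+\mathrm{wcat}(C)+1$. 3. If $E\xrightarrow{p}B\xrightarrow{j}C_p$ is a cofibre sequence (that is, $C_p$ with $j$ is a homotopy pushout of $*\leftarrow E\xrightarrow{p}B$) and $f:X\to B$ is any map, then $\mathrm{wsecat}(jf)\le\mathrm{wsecat}(f)+1$.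 4. If $E\xrightarrow{p}B\xrightarrow{j}C_p$ is a cofibre sequence, then $\mathrm{wcat}(C_p)\le\mathrm{wsecat}(p)+1$. -/

import Mathlib

open scoped unitInterval

universe u

noncomputable section

namespace WSecat

/-! ### Topological preliminaries on compactly generated (compactly coherent) spaces -/

/-- Quotients of compactly generated spaces are compactly generated. -/
instance instCGQuot {X : Type u} [TopologicalSpace X] [CompactlyCoherentSpace X]
    (r : X → X → Prop) : CompactlyCoherentSpace (Quot r) := by
  refine .of_isOpen_forall_compactSpace fun s hs ↦ ?_
  refine isQuotientMap_quot_mk.isOpen_preimage.mp ?_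
  refine (CompactlyCoherentSpace.isOpen_iff_forall_compactSpace _).mpr fun K _ _ f hf ↦ ?_
  exact hs K (fun k ↦ Quot.mk r (f k)) (continuous_quot_mk.comp hf)

/-- Binary disjoint unions of compactly generated spaces are compactly generated. -/
instance instCGSum {X Y : Type u} [TopologicalSpace X] [CompactlyCoherentSpace X]
    [TopologicalSpace Y] [CompactlyCoherentSpace Y] : CompactlyCoherentSpace (X ⊕ Y) := by
  refine .of_isOpen_forall_compactSpace fun s hs ↦ isOpen_sum_iff.mpr ⟨?_, ?_⟩
  · refine (CompactlyCoherentSpace.isOpen_iff_forall_compactSpace _).mpr fun K _ _ f hf ↦ ?_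
    exact hs K (fun k ↦ Sum.inl (f k)) (continuous_inl.comp hf)
  · refine (CompactlyCoherentSpace.isOpen_iff_forall_compactSpace _).mpr fun K _ _ f hf ↦ ?_
    exact hs K (fun k ↦ Sum.inr (f k)) (continuous_inr.comp hf)

/-- The product of the unit interval with a compactly generated space is compactly generated. -/
instance instCGIntervalProd {X : Type u} [TopologicalSpace X] [CompactlyCoherentSpace X] :
    CompactlyCoherentSpace (I × X) := by
  refine .of_isOpen_forall_compactSpace fun U hU ↦ ?_
  rw [isOpen_iff_mem_nhds]
  rintro ⟨t₀, x₀⟩ hx₀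
  have hopen : IsOpen {t : I | (t, x₀) ∈ U} := by
    have h1 := hU (ULift.{u} I) (fun t ↦ (t.down, x₀)) (by fun_prop)
    exact h1.preimage continuous_uliftUp
  obtain ⟨J, hJ, hJU, hJc⟩ := local_compact_nhds (hopen.mem_nhds hx₀)
  have hV : IsOpen {x : X | ∀ t ∈ J, (t, x) ∈ U} := by
    refine (CompactlyCoherentSpace.isOpen_iff_forall_compactSpace _).mpr fun K _ _ f hf ↦ ?_
    have : CompactSpace J := isCompact_iff_compactSpace.mp hJc
    have h2 := hU (J × K) (fun q ↦ (q.1.1, f q.2)) (by fun_prop)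
    have h3 : IsClosed (Prod.snd '' ((fun q : J × K ↦ ((q.1.1, f q.2) : I × X)) ⁻¹' U)ᶜ) :=
      isClosedMap_snd_of_compactSpace _ h2.isClosed_compl
    convert h3.isOpen_compl using 1
    ext k
    simp
  refine Filter.mem_of_superset (prod_mem_nhds hJ (hV.mem_nhds (x := x₀) hJU)) ?_
  rintro ⟨t, x⟩ ⟨ht, hx⟩
  exact hx t ht

/-- A map from a compactly generated space into a compact coherentification is continuous as soon
as the underlying map is. -/
theorem continuous_toK {X Y : Type*} [TopologicalSpace X] [CompactlyCoherentSpace X]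
    [TopologicalSpace Y] {f : X → Y} (hf : Continuous f) :
    Continuous (fun x ↦ CompactCoherentification.mk Y (f x)) :=
  (CompactCoherentification.continuous_map_of_continuous hf).comp
    CompactCoherentification.continuous_mk

/-! ### Pointed spaces and pointed maps -/

/-- A pointed compactly generated space. -/
structure PtSpace where
  carrier : Type u
  [top : TopologicalSpace carrier]
  [cg : CompactlyCoherentSpace carrier]
  pt : carrier

instance : CoeSort PtSpace.{u} (Type u) := ⟨PtSpace.carrier⟩

attribute [instance] PtSpace.top PtSpace.cg

/-- A well-pointed compactly generated Hausdorff space: the inclusion of the base point has the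
homotopy extension property. (The base point is automatically closed.) -/
structure WPSpace extends PtSpace.{u} where
  t2 : T2Space carrier
  hep : ∀ (Y : Type u) [TopologicalSpace Y] (f : C(carrier, Y)) (h : C(I, Y)), h 0 = f pt →
    ∃ H : C(I × carrier, Y), (∀ x, H (0, x) = f x) ∧ ∀ t, H (t, pt) = h t

instance : Coe WPSpace.{u} PtSpace.{u} := ⟨WPSpace.toPtSpace⟩

/-- Pointed continuous maps. -/
structure PtMap (X Y : PtSpace.{u}) where
  map : C(X, Y)
  map_pt : map X.pt = Y.pt

namespace PtMap

variable {X Y Z W : PtSpace.{u}}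

/-- The identity. -/
def id (X : PtSpace.{u}) : PtMap X X := ⟨ContinuousMap.id _, rfl⟩

/-- The composite `g ∘ f`. -/
def comp (g : PtMap Y Z) (f : PtMap X Y) : PtMap X Z :=
  ⟨g.map.comp f.map, (congrArg g.map f.map_pt).trans g.map_pt⟩

/-- The trivial map. -/
def const (X Y : PtSpace.{u}) : PtMap X Y := ⟨ContinuousMap.const _ Y.pt, rfl⟩

end PtMap

/-- Pointed homotopies. -/
abbrev PtHomotopy {X Y : PtSpace.{u}} (f g : PtMap X Y) : Type u :=
  ContinuousMap.HomotopyRel f.map g.map {X.pt}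

/-- Two pointed maps are pointed homotopic. -/
def PtHomotopic {X Y : PtSpace.{u}} (f g : PtMap X Y) : Prop := Nonempty (PtHomotopy f g)

/-- A map is homotopically trivial. -/
def IsTrivial {X Y : PtSpace.{u}} (f : PtMap X Y) : Prop := PtHomotopic f (PtMap.const X Y)

/-- Pointed homotopy equivalences. -/
def IsEquivalence {X Y : PtSpace.{u}} (f : PtMap X Y) : Prop :=
  ∃ g : PtMap Y X, PtHomotopic (g.comp f) (PtMap.id X) ∧ PtHomotopic (f.comp g) (PtMap.id Y)

namespace PtHomotopy

variable {X Y Z : PtSpace.{u}}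

/-- Reversal of a pointed homotopy. -/
def symm {f g : PtMap X Y} (H : PtHomotopy f g) : PtHomotopy g f := ContinuousMap.HomotopyRel.symm H

/-- Concatenation of pointed homotopies. -/
def trans {f g h : PtMap X Y} (H : PtHomotopy f g) (K : PtHomotopy g h) :
    PtHomotopy f h := ContinuousMap.HomotopyRel.trans H K

/-- The homotopy `k ∘ H : k ∘ f ≃ k ∘ g`. -/
def postcomp {f g : PtMap X Y} (H : PtHomotopy f g) (k : PtMap Y Z) :
    PtHomotopy (k.comp f) (k.comp g) := ContinuousMap.HomotopyRel.compContinuousMap H k.map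

/-- The homotopy `H ∘ k : f ∘ k ≃ g ∘ k`. -/
def precomp {f g : PtMap Y Z} (H : PtHomotopy f g) (k : PtMap X Y) :
    PtHomotopy (f.comp k) (g.comp k) where
  toHomotopy := H.toHomotopy.compContinuousMap k.map
  prop' t x hx := by
    have hx' : k.map x ∈ ({Y.pt} : Set Y) := by
      rw [Set.mem_singleton_iff] at hx ⊢
      rw [hx, k.map_pt]
    exact H.prop t (k.map x) hx'

end PtHomotopy

/-! ### Points, products and powers -/

/-- The one-point space. -/
def point : PtSpace.{u} := ⟨PUnit.{u + 1}, PUnit.unit⟩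

/-- The product `X × Y` in compactly generated spaces. -/
def prod (X Y : PtSpace.{u}) : PtSpace.{u} where
  carrier := CompactCoherentification (X × Y)
  pt := CompactCoherentification.mk _ (X.pt, Y.pt)

/-- The product map `f × g`. -/
def prodMap {X X' Y Y' : PtSpace.{u}} (f : PtMap X X') (g : PtMap Y Y') :
    PtMap (prod X Y) (prod X' Y') where
  map :=
    { toFun := CompactCoherentification.map (Prod.map f.map g.map)
      continuous_toFun := CompactCoherentification.continuous_map_of_continuous
        (X := X × Y) (Y := X' × Y') (f.map.continuous.prodMap g.map.continuous) }
  map_pt := congrArg (CompactCoherentification.mk _) (Prod.ext f.map_pt g.map_pt)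

/-- The map `(f, g) : X → Y × Z`. -/
def prodLift {X Y Z : PtSpace.{u}} (f : PtMap X Y) (g : PtMap X Z) : PtMap X (prod Y Z) where
  map :=
    { toFun := fun x ↦ CompactCoherentification.mk (Y × Z) (f.map x, g.map x)
      continuous_toFun := continuous_toK (Y := Y × Z)
        (f.map.continuous.prodMk g.map.continuous) }
  map_pt := congrArg (CompactCoherentification.mk _) (Prod.ext f.map_pt g.map_pt)

/-- `power B n` is the `(n + 1)`-fold product `B ^ (n + 1) = (B × B) × ⋯ × B`. -/
def power (B : PtSpace.{u}) : ℕ → PtSpace.{u}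
  | 0 => B
  | n + 1 => prod (power B n) B

/-- The diagonal `B → B ^ (n + 1)`. -/
def diag (B : PtSpace.{u}) : (n : ℕ) → PtMap B (power B n)
  | 0 => PtMap.id B
  | n + 1 => prodLift (diag B n) (PtMap.id B)

/-! ### Weak category -/

/-- The fat wedge: the points of `B ^ (n + 1)` with some coordinate equal to the base point. -/
def fatWedge (B : PtSpace.{u}) : (n : ℕ) → Set (power B n)
  | 0 => {B.pt}
  | n + 1 => {z : CompactCoherentification (power B n × B) |
      ((CompactCoherentification.mk (power B n × B)).symm z).1 ∈ fatWedge B n ∨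
      ((CompactCoherentification.mk (power B n × B)).symm z).2 = B.pt}

/-- The `(n + 1)`-fold smash product: `B ^ (n + 1)` with the fat wedge collapsed to a point. -/
def smashPower (B : PtSpace.{u}) (n : ℕ) : PtSpace.{u} where
  carrier := Quot fun x y : power B n ↦ x ∈ fatWedge B n ∧ y ∈ fatWedge B n
  pt := Quot.mk _ (power B n).pt

/-- The reduced diagonal `B → B ^ (n + 1) → B ^ [n + 1]`. -/
def reducedDiag (B : PtSpace.{u}) (n : ℕ) : PtMap B (smashPower B n) where
  map := ⟨fun b ↦ Quot.mk _ ((diag B n).map b),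
    continuous_quot_mk.comp (diag B n).map.continuous⟩
  map_pt := congrArg (Quot.mk _) (diag B n).map_pt

/-- The weak category of `B`: the least `n` such that the reduced diagonal
`B → B ^ [n + 1]` is homotopically trivial, and `∞` if there is none. -/
def wcat (B : PtSpace.{u}) : ℕ∞ :=
  ⨅ (n : ℕ) (_ : IsTrivial (reducedDiag B n)), (n : ℕ∞)

/-! ### Standard homotopy pullbacks -/

section HoPullback

variable {A B C : PtSpace.{u}} (f : PtMap A C) (g : PtMap B C)

/-- Triples `(a, ω, b)` where `ω` is a path in `C` from `f a` to `g b`. -/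
abbrev HoPullbackSet : Type u :=
  {z : A × C(I, C) × B // z.2.1 0 = f.map z.1 ∧ z.2.1 1 = g.map z.2.2}

/-- The standard homotopy pullback of `f : A → C` and `g : B → C`. -/
def hoPullback : PtSpace.{u} where
  carrier := CompactCoherentification (HoPullbackSet f g)
  pt := CompactCoherentification.mk _
    ⟨(A.pt, ContinuousMap.const I C.pt, B.pt), f.map_pt.symm, g.map_pt.symm⟩

/-- The triple underlying a point of the standard homotopy pullback. -/
def hoPullbackVal (z : hoPullback f g) : A × C(I, C) × B :=
  ((CompactCoherentification.mk (HoPullbackSet f g)).symm z).1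

theorem continuous_hoPullbackVal : Continuous (hoPullbackVal f g) :=
  continuous_subtype_val.comp CompactCoherentification.continuous_mk_symm

/-- The projection to `A`. -/
def hoPullbackFst : PtMap (hoPullback f g) A where
  map := ⟨fun z ↦ (hoPullbackVal f g z).1, continuous_fst.comp (continuous_hoPullbackVal f g)⟩
  map_pt := rfl

/-- The projection to `B`. -/
def hoPullbackSnd : PtMap (hoPullback f g) B where
  map := ⟨fun z ↦ (hoPullbackVal f g z).2.2,
    (continuous_snd.comp continuous_snd).comp (continuous_hoPullbackVal f g)⟩
  map_pt := rfl

/-- The homotopy `(t, (a, ω, b)) ↦ ω t` filling the standard homotopy pullback square. -/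
def hoPullbackHomotopy :
    PtHomotopy (f.comp (hoPullbackFst f g)) (g.comp (hoPullbackSnd f g)) where
  toFun q := (hoPullbackVal f g q.2).2.1 q.1
  continuous_toFun := by
    have h := continuous_hoPullbackVal f g
    fun_prop
  map_zero_left z := ((CompactCoherentification.mk (HoPullbackSet f g)).symm z).2.1
  map_one_left z := ((CompactCoherentification.mk (HoPullbackSet f g)).symm z).2.2
  prop' t z hz := by
    rw [Set.mem_singleton_iff] at hz
    subst hz
    exact f.map_pt.symm

end HoPullback

/-! ### Standard homotopy pushouts -/

section HoPushout

variable {A B C : PtSpace.{u}} (g : PtMap A B) (f : PtMap A C)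

/-- The identifications in the reduced double mapping cylinder of `B ← A → C`. -/
inductive CylRel : B ⊕ ((I × A) ⊕ C) → B ⊕ ((I × A) ⊕ C) → Prop
  | left (a : A) : CylRel (Sum.inr (Sum.inl (0, a))) (Sum.inl (g.map a))
  | right (a : A) : CylRel (Sum.inr (Sum.inl (1, a))) (Sum.inr (Sum.inr (f.map a)))
  | base (t : I) : CylRel (Sum.inr (Sum.inl (t, A.pt))) (Sum.inl B.pt)

/-- The standard (pointed) homotopy pushout of `g : A → B` and `f : A → C`: the reduced double
mapping cylinder. -/
def hoPushout : PtSpace.{u} where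
  carrier := Quot (CylRel g f)
  pt := Quot.mk _ (Sum.inl B.pt)

/-- The map `B → hoPushout g f`. -/
def hoPushoutInl : PtMap B (hoPushout g f) where
  map := ⟨fun b ↦ Quot.mk _ (Sum.inl b), continuous_quot_mk.comp continuous_inl⟩
  map_pt := rfl

/-- The map `C → hoPushout g f`. -/
def hoPushoutInr : PtMap C (hoPushout g f) where
  map := ⟨fun c ↦ Quot.mk _ (Sum.inr (Sum.inr c)),
    continuous_quot_mk.comp (continuous_inr.comp continuous_inr)⟩
  map_pt := by
    have h1 : Quot.mk (CylRel g f) (Sum.inr (Sum.inl (1, A.pt))) = Quot.mk _ (Sum.inl B.pt) :=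
      Quot.sound (CylRel.base 1)
    have h2 := Quot.sound (CylRel.right (g := g) (f := f) A.pt)
    rw [f.map_pt] at h2
    exact h2.symm.trans h1

variable {g f}

/-- The co-whisker map `hoPushout g f → D` induced by `i : B → D`, `j : C → D` and a homotopy
`H : i ∘ g ≃ j ∘ f`; it is `i` on `B`, `j` on `C` and `H` on the cylinder. -/
def coWhisker {D : PtSpace.{u}} {i : PtMap B D} {j : PtMap C D}
    (H : PtHomotopy (i.comp g) (j.comp f)) : PtMap (hoPushout g f) D where
  map :=
    { toFun := Quot.lift (Sum.elim i.map (Sum.elim (fun q ↦ H q) j.map)) (by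
        rintro _ _ (a | a | t)
        · exact H.apply_zero a
        · exact H.apply_one a
        · refine (H.eq_fst t (Set.mem_singleton _)).trans ?_
          exact congrArg i.map g.map_pt)
      continuous_toFun := by
        refine continuous_quot_lift _ ?_
        exact i.map.continuous.sumElim (H.continuous.sumElim j.map.continuous) }
  map_pt := i.map_pt

/-- The homotopy commutative square with sides `g`, `f`, `i`, `j` and homotopy `H` is a homotopy
pushout: the map from the standard homotopy pushout is a homotopy equivalence. -/
def IsHoPushout {D : PtSpace.{u}} {i : PtMap B D} {j : PtMap C D}
    (H : PtHomotopy (i.comp g) (j.comp f)) : Prop := IsEquivalence (coWhisker H)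

end HoPushout

/-- Given two squares `i' g' ≃ j' f'` (with corner `D'`) and `i g ≃ j f` (with corner `D`) and a
homotopy commutative map of spans `(β, α, γ)` with homotopies `K : β g' ≃ g α` and
`L : f α ≃ γ f'`, a map `δ : D' → D` is induced by these data if, on the standard homotopy pushout
of the first span, it restricts up to homotopy to the co-whisker map of
`i β`, `j γ` and the composite homotopy `i β g' ≃ i g α ≃ j f α ≃ j γ f'`. -/
def IsInducedMap {A B C D A' B' C' D' : PtSpace.{u}}
    {g : PtMap A B} {f : PtMap A C} {i : PtMap B D} {j : PtMap C D}
    {g' : PtMap A' B'} {f' : PtMap A' C'} {i' : PtMap B' D'} {j' : PtMap C' D'}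
    {α : PtMap A' A} {β : PtMap B' B} {γ : PtMap C' C}
    (H' : PtHomotopy (i'.comp g') (j'.comp f')) (H : PtHomotopy (i.comp g) (j.comp f))
    (K : PtHomotopy (β.comp g') (g.comp α)) (L : PtHomotopy (f.comp α) (γ.comp f'))
    (δ : PtMap D' D) : Prop :=
  PtHomotopic (δ.comp (coWhisker H'))
    (coWhisker (i := i.comp β) (j := j.comp γ) (g := g') (f := f')
      (PtHomotopy.trans (f := (i.comp β).comp g') (g := (i.comp g).comp α)
        (h := (j.comp γ).comp f') (PtHomotopy.postcomp K i)
        (PtHomotopy.trans (g := (j.comp f).comp α) (PtHomotopy.precomp H α)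
          (PtHomotopy.postcomp L j))))

/-- The homotopy cofibre `C_f` of `f : X → Y`. -/
def cofibre {X Y : PtSpace.{u}} (f : PtMap X Y) : PtSpace.{u} :=
  hoPushout (PtMap.const X point) f

/-- The induced map `Y → C_f`. -/
def toCofibre {X Y : PtSpace.{u}} (f : PtMap X Y) : PtMap Y (cofibre f) :=
  hoPushoutInr (PtMap.const X point) f

/-- `E → B → C` is a cofibre sequence: `C`, with `j : B → C`, is a homotopy pushout of
`* ← E → B`. -/
def IsCofibreSequence {E B C : PtSpace.{u}} (p : PtMap E B) (j : PtMap B C) : Prop :=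
  ∃ H : PtHomotopy ((PtMap.const point C).comp (PtMap.const E point)) (j.comp p), IsHoPushout H

/-! ### Joins, sectional fat wedges and weak sectional category -/

/-- The join `A *_C B`: the homotopy pushout of the homotopy pullback of `f` and `g`. -/
def join {A B C : PtSpace.{u}} (f : PtMap A C) (g : PtMap B C) : PtSpace.{u} :=
  hoPushout (hoPullbackFst f g) (hoPullbackSnd f g)

/-- The co-whisker map `A *_C B → C`. -/
def joinMap {A B C : PtSpace.{u}} (f : PtMap A C) (g : PtMap B C) : PtMap (join f g) C :=
  coWhisker (hoPullbackHomotopy f g)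

/-- The `n`-sectional fat wedge `κ_n : T^n(p) → B ^ (n + 1)`: `κ_0 = p`, and `κ_(n+1)` is the join
of `κ_n × id` and `id × p`. -/
def sectionalFatWedge {E B : PtSpace.{u}} (p : PtMap E B) :
    (n : ℕ) → (T : PtSpace.{u}) × PtMap T (power B n)
  | 0 => ⟨E, p⟩
  | n + 1 =>
    ⟨join (prodMap (sectionalFatWedge p n).2 (PtMap.id B)) (prodMap (PtMap.id (power B n)) p),
      joinMap (prodMap (sectionalFatWedge p n).2 (PtMap.id B)) (prodMap (PtMap.id (power B n)) p)⟩

/-- The weak sectional category of `p : E → B`: the least `n` such that the composite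
`B → B ^ (n + 1) → C_(κ_n)` is homotopically trivial, and `∞` if there is none. -/
def wsecat {E B : PtSpace.{u}} (p : PtMap E B) : ℕ∞ :=
  ⨅ (n : ℕ) (_ : IsTrivial ((toCofibre (sectionalFatWedge p n).2).comp (diag B n))), (n : ℕ∞)

end WSecat

end

noncomputable section

namespace WSecat

/-! ### Products of quotient maps in compactly generated spaces -/

/-! The proof replaces sectional category by the weak category of a map. Say that `u : B → Q` has
weak category at most `n` (`WcatLE u n`) if `u` followed by the reduced diagonal of `Q` into its `(n
+ 1)`-fold smash power is trivial. Three facts carry everything.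

Subadditivity over a homotopy pushout (`WcatLE.of_isHoPushout`) is the cup-length argument with
smash products. The reduced diagonal with `n + m + 2` factors is a product of one with `n + 1`
factors and one with `m + 1` factors. If the first is trivial on one leg and the second on the
other, each can be made constant on its half of the double mapping cylinder, so the product is
constant (`isTrivial_pairing_of_cover`).

If `p` satisfies the weak sectional condition at level `n` and `u ∘ p` is trivial, then `u` has weak
category at most `n` (`WcatLE.of_isTrivial_comp`). The smashed power of `u` kills each join `κ_n` by
induction (`isTrivial_joinMap`), so it extends over the cofibre of `κ_n`, where the diagonal is
trivial.

Conversely, if `B → C_p` has weak category at most `n`, then `p` satisfies the weak sectional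
condition at level `n` (`isTrivial_toCofibre_diag`). Here a map from the `(n + 1)`-fold power of the
cone of `p` to the cone of `κ_n` is built from an explicit pairing of cones (`conePairing`). It
sends the fat wedge to the vertex and respects diagonals. Strict triviality on the wedge requires
unreduced cones pointed at the vertex, because a pair `(*, b)` need not be sent to the base point.
Well-pointedness (`exists_cofibre_to_uCofibre`, `isTrivial_of_homotopic_const`) passes between the
two kinds of cone.

For part 1 take `u : D → C_δ`. Its restrictions along `B` and `C` become trivial on `β` and `γ`,
since both factor up to homotopy through `δ`. Part 3 is the same with the point as one leg; parts 2
and 4 take `u` to be the identity.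

The Hausdorff lemmas serve the two pairings: each is defined on a product of quotients, and its
continuity rests on `continuous_of_quotient_prod`. -/

open Topology in
/-- A function on `Y × L`, with `Y` compactly generated and `L` locally compact, is continuous if
it is continuous on `K × L` for all compact `K`. -/
theorem continuous_of_forall_compact_prod {Y L V : Type*} [TopologicalSpace Y]
    [CompactlyCoherentSpace Y] [TopologicalSpace L] [LocallyCompactSpace L] [TopologicalSpace V]
    (h : Y × L → V)
    (hK : ∀ K : Set Y, IsCompact K → Continuous fun q : K × L ↦ h (q.1, q.2)) :
    Continuous h := by
  have hy (y : Y) : Continuous fun l ↦ h (y, l) :=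
    (hK {y} isCompact_singleton).comp (g := fun q : ({y} : Set Y) × L ↦ h (q.1, q.2))
      (f := fun l ↦ ((⟨y, rfl⟩ : ({y} : Set Y)), l)) (by fun_prop)
  -- After currying, continuity into the function space can be tested on compact subsets of `Y`;
  -- local compactness of `L` allows uncurrying.
  let c : Y → C(L, V) := fun y ↦ ⟨fun l ↦ h (y, l), hy y⟩
  have hc : Continuous c := by
    rw [CompactlyCoherentSpace.isCoherentWith.continuous_iff]
    intro K hK'
    rw [continuousOn_iff_continuous_domRestrict]
    exact (ContinuousMap.curry ⟨_, hK K hK'⟩).continuous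
  exact (ContinuousMap.uncurry ⟨c, hc⟩).continuous

open Topology in
/-- In compactly generated spaces, products of quotient maps are quotient maps. -/
theorem continuous_of_quotient_prod {Y₀ Y Z₀ Z : Type u} {V : Type*} [TopologicalSpace Y₀]
    [TopologicalSpace Y] [TopologicalSpace Z₀] [TopologicalSpace Z] [TopologicalSpace V]
    [CompactlyCoherentSpace Y₀] [CompactlyCoherentSpace Z₀] [T2Space Y₀] [T2Space Z]
    {p : Y₀ → Y} {q : Z₀ → Z} (hp : IsQuotientMap p) (hq : IsQuotientMap q) (h : Y × Z → V)
    (hc : Continuous fun w : CompactCoherentification (Y₀ × Z₀) ↦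
      h (p ((CompactCoherentification.mk (Y₀ × Z₀)).symm w).1,
        q ((CompactCoherentification.mk (Y₀ × Z₀)).symm w).2)) :
    Continuous fun w : CompactCoherentification (Y × Z) ↦
      h ((CompactCoherentification.mk (Y × Z)).symm w) := by
  -- A compact subset of `Y × Z` projects to a compact `L ⊆ Z`, so `Y × L` suffices. Compact
  -- Hausdorff factors are locally compact, and multiplying by them preserves quotient maps; this is
  -- applied to `p` against `L`, then to `q` against compact `K ⊆ Y₀`.
  have key (L : Set Z) (hL : IsCompact L) : Continuous fun w : Y × L ↦ h (w.1, w.2) := by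
    have : CompactSpace L := isCompact_iff_compactSpace.mp hL
    refine hp.continuous_lift_prod_left ?_
    refine continuous_of_forall_compact_prod _ fun K hK ↦ ?_
    have : CompactSpace K := isCompact_iff_compactSpace.mp hK
    have h1 : Continuous fun w : K × Z ↦ h (p w.1, w.2) := by
      refine hq.continuous_lift_prod_right ?_
      have h2 : Continuous fun w : Z₀ × K ↦ h (p w.2, q w.1) := by
        refine continuous_of_forall_compact_prod _ fun M hM ↦ ?_
        have : CompactSpace M := isCompact_iff_compactSpace.mp hM
        exact hc.comp (continuous_toK (X := M × K) (Y := Y₀ × Z₀)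
          (f := fun w ↦ (w.2.1, w.1.1)) (by fun_prop))
      exact h2.comp continuous_swap
    exact h1.comp (f := fun w : K × L ↦ (w.1, w.2.1)) (by fun_prop)
  refine CompactCoherentification.continuous_dom_iff.mpr fun K hK ↦ ?_
  rw [continuousOn_iff_continuous_domRestrict]
  have hL := hK.image continuous_snd
  exact (key _ hL).comp
    (f := fun w : K ↦ (w.1.1, (⟨w.1.2, w.1, w.2, rfl⟩ : Prod.snd '' K))) (by fun_prop)

/-- A function on `(A ⊕ B) × Z`, in compactly generated spaces, is continuous if it is continuous
on `A × Z` and on `B × Z`. -/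
theorem continuous_prod_sum {A B Z : Type u} {V : Type*} [TopologicalSpace A]
    [TopologicalSpace B] [TopologicalSpace Z] [TopologicalSpace V] (h : (A ⊕ B) × Z → V)
    (hA : Continuous fun w : CompactCoherentification (A × Z) ↦
      h (Sum.inl ((CompactCoherentification.mk (A × Z)).symm w).1,
        ((CompactCoherentification.mk (A × Z)).symm w).2))
    (hB : Continuous fun w : CompactCoherentification (B × Z) ↦
      h (Sum.inr ((CompactCoherentification.mk (B × Z)).symm w).1,
        ((CompactCoherentification.mk (B × Z)).symm w).2)) :
    Continuous fun w : CompactCoherentification ((A ⊕ B) × Z) ↦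
      h ((CompactCoherentification.mk ((A ⊕ B) × Z)).symm w) := by
  refine CompactCoherentification.continuous_dom_iff.mpr fun K hK ↦ ?_
  let e := (Homeomorph.sumProdDistrib (X := A) (Y := B) (Z := Z))
  have hK' := hK.image e.continuous
  -- A compact set meets each summand in a compact set, the summands being closed.
  have h1 := CompactCoherentification.continuous_dom_iff.mp hA _
    ((Topology.IsClosedEmbedding.inl (X := A × Z) (Y := B × Z)).isCompact_preimage hK')
  have h2 := CompactCoherentification.continuous_dom_iff.mp hB _
    ((Topology.IsClosedEmbedding.inr (X := A × Z) (Y := B × Z)).isCompact_preimage hK')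
  have h3 : ContinuousOn (h ∘ e.symm) (e '' K) := by
    rintro (w | w) hw
    · rw [ContinuousWithinAt, ← Topology.IsOpenEmbedding.inl.map_nhdsWithin_preimage_eq,
        Filter.tendsto_map'_iff]
      exact h1 w hw
    · rw [ContinuousWithinAt, ← Topology.IsOpenEmbedding.inr.map_nhdsWithin_preimage_eq,
        Filter.tendsto_map'_iff]
      exact h2 w hw
  have h4 := h3.comp e.continuous.continuousOn (Set.mapsTo_image e K)
  convert h4 using 1
  ext w
  simp

theorem continuous_prod_swap {Y Z : Type u} {V : Type*} [TopologicalSpace Y]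
    [TopologicalSpace Z] [TopologicalSpace V] (h : Y × Z → V)
    (hc : Continuous fun w : CompactCoherentification (Z × Y) ↦
      h ((CompactCoherentification.mk (Z × Y)).symm w).swap) :
    Continuous fun w : CompactCoherentification (Y × Z) ↦
      h ((CompactCoherentification.mk (Y × Z)).symm w) :=
  hc.comp (CompactCoherentification.continuous_map_of_continuous
    (X := Y × Z) (Y := Z × Y) continuous_swap)

/-! ### Hausdorff quotients -/

/-- A quotient is Hausdorff if points with different images have disjoint saturated
neighbourhoods. -/
theorem t2Space_quot {X : Type*} [TopologicalSpace X] {r : X → X → Prop}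
    (h : ∀ x y, Quot.mk r x ≠ Quot.mk r y → ∃ U V : Set X, IsOpen U ∧ IsOpen V ∧
      (∀ a b, r a b → (a ∈ U ↔ b ∈ U)) ∧ (∀ a b, r a b → (a ∈ V ↔ b ∈ V)) ∧
      x ∈ U ∧ y ∈ V ∧ Disjoint U V) : T2Space (Quot r) := by
  refine ⟨fun p q ↦ Quot.induction_on₂ p q fun x y hxy ↦ ?_⟩
  obtain ⟨U, V, hU, hV, hrU, hrV, hx, hy, hUV⟩ := h x y hxy
  refine ⟨{w | Quot.lift (· ∈ U) (fun a b hab ↦ propext (hrU a b hab)) w},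
    {w | Quot.lift (· ∈ V) (fun a b hab ↦ propext (hrV a b hab)) w},
    isQuotientMap_quot_mk.isOpen_preimage.mp hU, isQuotientMap_quot_mk.isOpen_preimage.mp hV,
    hx, hy, Set.disjoint_left.mpr ?_⟩
  rintro ⟨w⟩
  exact fun h1 h2 ↦ Set.disjoint_left.mp hUV h1 h2

/-- A set which can be separated from every point outside it. -/
def SeparatedFromPoints {X : Type*} [TopologicalSpace X] (F : Set X) : Prop :=
  ∀ x ∉ F, ∃ U V : Set X, IsOpen U ∧ IsOpen V ∧ x ∈ U ∧ F ⊆ V ∧ Disjoint U V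

/-- The only nontrivial class is `F`, so an open set containing or missing `F` is saturated. Two
points outside `F` are separated in `X` after shrinking to neighbourhoods that miss `F`. -/
theorem t2Space_quot_of_separatedFromPoints {X : Type*} [TopologicalSpace X] [T2Space X]
    {F : Set X} (hF : SeparatedFromPoints F) :
    T2Space (Quot fun x y : X ↦ x ∈ F ∧ y ∈ F) := by
  refine t2Space_quot fun x y hxy ↦ ?_
  by_cases hx : x ∈ F
  · have hy : y ∉ F := fun hy ↦ hxy (Quot.sound ⟨hx, hy⟩)
    obtain ⟨U, V, hU, hV, hyU, hFV, hUV⟩ := hF y hy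
    refine ⟨V, U, hV, hU, fun a b h ↦ ⟨fun _ ↦ hFV h.2, fun _ ↦ hFV h.1⟩, fun a b h ↦ ?_,
      hFV hx, hyU, hUV.symm⟩
    exact iff_of_false (fun ha ↦ Set.disjoint_left.mp hUV ha (hFV h.1))
      fun hb ↦ Set.disjoint_left.mp hUV hb (hFV h.2)
  · obtain ⟨U, V, hU, hV, hxU, hFV, hUV⟩ := hF x hx
    by_cases hy : y ∈ F
    · refine ⟨U, V, hU, hV, fun a b h ↦ ?_, fun a b h ↦ ⟨fun _ ↦ hFV h.2, fun _ ↦ hFV h.1⟩,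
        hxU, hFV hy, hUV⟩
      exact iff_of_false (fun ha ↦ Set.disjoint_left.mp hUV ha (hFV h.1))
        fun hb ↦ Set.disjoint_left.mp hUV hb (hFV h.2)
    · obtain ⟨U', V', hU', hV', hyU', hFV', hUV'⟩ := hF y hy
      obtain ⟨A, B, hA, hB, hxA, hyB, hAB⟩ := t2_separation fun e : x = y ↦ hxy (e ▸ rfl)
      refine ⟨U ∩ A, U' ∩ B, hU.inter hA, hU'.inter hB, fun a b h ↦ ?_, fun a b h ↦ ?_,
        ⟨hxU, hxA⟩, ⟨hyU', hyB⟩, hAB.mono Set.inter_subset_right Set.inter_subset_right⟩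
      · exact iff_of_false (fun ha ↦ Set.disjoint_left.mp hUV ha.1 (hFV h.1))
          fun hb ↦ Set.disjoint_left.mp hUV hb.1 (hFV h.2)
      · exact iff_of_false (fun ha ↦ Set.disjoint_left.mp hUV' ha.1 (hFV' h.1))
          fun hb ↦ Set.disjoint_left.mp hUV' hb.1 (hFV' h.2)

instance t2Space_prod {X Y : PtSpace.{u}} [T2Space X] [T2Space Y] : T2Space (prod X Y) :=
  inferInstanceAs (T2Space (CompactCoherentification (X × Y)))

instance t2Space_power {B : PtSpace.{u}} [T2Space B] : (n : ℕ) → T2Space (power B n)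
  | 0 => inferInstanceAs (T2Space B)
  | n + 1 => by
    have := t2Space_power (B := B) n
    exact inferInstanceAs (T2Space (prod (power B n) B))

/-- Off the fat wedge both factors avoid their closed conditions. A product neighbourhood of the
point is disjoint from the union of the two cylinders over neighbourhoods of the smaller fat wedge
and of the base point. -/
theorem separatedFromPoints_fatWedge {B : PtSpace.{u}} [T2Space B] (n : ℕ) :
    SeparatedFromPoints (fatWedge B n) := by
  induction n with
  | zero =>
    intro x hx
    obtain ⟨U, V, hU, hV, hxU, hV', hUV⟩ := t2_separation (X := B) (x := x) (y := B.pt) hx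
    exact ⟨U, V, hU, hV, hxU, Set.singleton_subset_iff.mpr hV', hUV⟩
  | succ n ih =>
    intro z hz
    let e : power B (n + 1) → power B n × B := (CompactCoherentification.mk (power B n × B)).symm
    have he : Continuous e := CompactCoherentification.continuous_mk_symm
    have hz' : ¬((e z).1 ∈ fatWedge B n ∨ (e z).2 = B.pt) := hz
    rw [not_or] at hz'
    obtain ⟨U₁, V₁, hU₁, hV₁, hx₁, hF, hd₁⟩ := ih _ hz'.1
    obtain ⟨U₂, V₂, hU₂, hV₂, hx₂, hp, hd₂⟩ := t2_separation hz'.2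
    refine ⟨e ⁻¹' (U₁ ×ˢ U₂), e ⁻¹' (Prod.fst ⁻¹' V₁ ∪ Prod.snd ⁻¹' V₂),
      (hU₁.prod hU₂).preimage he,
      ((hV₁.preimage continuous_fst).union (hV₂.preimage continuous_snd)).preimage he,
      ⟨hx₁, hx₂⟩, ?_, Set.disjoint_left.mpr ?_⟩
    · rintro w (hw | hw)
      · exact Or.inl (hF hw)
      · refine Or.inr ?_
        change (e w).2 ∈ V₂
        have : (e w).2 = B.pt := hw
        rwa [this]
    · rintro w ⟨h1, h2⟩ (h3 | h3)
      · exact Set.disjoint_left.mp hd₁ h1 h3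
      · exact Set.disjoint_left.mp hd₂ h2 h3

instance t2Space_smashPower {B : PtSpace.{u}} [T2Space B] (n : ℕ) : T2Space (smashPower B n) :=
  t2Space_quot_of_separatedFromPoints (separatedFromPoints_fatWedge n)

instance t2Space_hoPullback {A B C : PtSpace.{u}} [T2Space A] [T2Space B] [T2Space C]
    (f : PtMap A C) (g : PtMap B C) : T2Space (hoPullback f g) :=
  inferInstanceAs (T2Space (CompactCoherentification (HoPullbackSet f g)))

instance t2Space_point : T2Space point.{u} := inferInstanceAs (T2Space PUnit)

section HoPushout

variable {A B C : PtSpace.{u}} (g : PtMap A B) (f : PtMap A C)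

/-- The arc of the double mapping cylinder which is collapsed to the base point. -/
def cylArc : Set (B ⊕ ((I × A) ⊕ C)) :=
  {w | w = Sum.inl B.pt ∨ (∃ t : I, w = Sum.inr (Sum.inl (t, A.pt))) ∨ w = Sum.inr (Sum.inr C.pt)}

/-- The subset of the double mapping cylinder with the given pieces is saturated for the
identifications at both ends of the cylinder. -/
structure IsEndSaturated (U : Set (B ⊕ ((I × A) ⊕ C))) : Prop where
  isOpen : IsOpen U
  left : ∀ a, Sum.inr (Sum.inl (0, a)) ∈ U ↔ Sum.inl (g.map a) ∈ U
  right : ∀ a, Sum.inr (Sum.inl (1, a)) ∈ U ↔ Sum.inr (Sum.inr (f.map a)) ∈ U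

/-- Two points of the double mapping cylinder have disjoint saturated neighbourhoods. -/
def EndSeparated (x y : B ⊕ ((I × A) ⊕ C)) : Prop :=
  ∃ U V, IsEndSaturated g f U ∧ IsEndSaturated g f V ∧ x ∈ U ∧ y ∈ V ∧ Disjoint U V

/-- The union of three pieces as a subset of the double mapping cylinder. -/
def cylSet (U : Set B) (V : Set (I × A)) (W : Set C) : Set (B ⊕ ((I × A) ⊕ C)) :=
  {w | Sum.elim (· ∈ U) (Sum.elim (· ∈ V) (· ∈ W)) w}

/-- The identifications at both ends of the unreduced double mapping cylinder of `B ← A → C`. -/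
inductive EndRel : B ⊕ ((I × A) ⊕ C) → B ⊕ ((I × A) ⊕ C) → Prop
  | left (a : A) : EndRel (Sum.inr (Sum.inl (0, a))) (Sum.inl (g.map a))
  | right (a : A) : EndRel (Sum.inr (Sum.inl (1, a))) (Sum.inr (Sum.inr (f.map a)))

variable {g f}

theorem EndSeparated.symm {x y : B ⊕ ((I × A) ⊕ C)} (h : EndSeparated g f x y) :
    EndSeparated g f y x := by
  obtain ⟨U, V, hU, hV, hx, hy, hd⟩ := h
  exact ⟨V, U, hV, hU, hy, hx, hd.symm⟩

theorem isOpen_cylSet {U : Set B} {V : Set (I × A)} {W : Set C} (hU : IsOpen U) (hV : IsOpen V)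
    (hW : IsOpen W) : IsOpen (cylSet U V W) :=
  isOpen_sum_iff.mpr ⟨hU, isOpen_sum_iff.mpr ⟨hV, hW⟩⟩

theorem disjoint_cylSet {U U' : Set B} {V V' : Set (I × A)} {W W' : Set C} (hU : Disjoint U U')
    (hV : Disjoint V V') (hW : Disjoint W W') : Disjoint (cylSet U V W) (cylSet U' V' W') := by
  refine Set.disjoint_left.mpr ?_
  rintro (w | w | w) h1 h2
  · exact Set.disjoint_left.mp hU h1 h2
  · exact Set.disjoint_left.mp hV h1 h2
  · exact Set.disjoint_left.mp hW h1 h2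

/-- Disjoint neighbourhoods in `B` are pulled back along `g` and spread over the cylinder; stopping
before height `1` keeps them saturated at the other end. -/
theorem endSeparated_inl_inl [T2Space B] {b b' : B} (h : b ≠ b') :
    EndSeparated g f (Sum.inl b) (Sum.inl b') := by
  obtain ⟨U, V, hU, hV, hb, hb', hd⟩ := t2_separation h
  have hg := g.map.continuous
  refine ⟨cylSet U {q | q.1 < 1 ∧ g.map q.2 ∈ U} ∅, cylSet V {q | q.1 < 1 ∧ g.map q.2 ∈ V} ∅,
    ⟨isOpen_cylSet hU ?_ isOpen_empty, ?_, ?_⟩, ⟨isOpen_cylSet hV ?_ isOpen_empty, ?_, ?_⟩,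
    hb, hb', disjoint_cylSet hd ?_ disjoint_bot_left⟩
  · exact (isOpen_Iio.preimage continuous_fst).inter (hU.preimage (by fun_prop))
  · intro a; simp [cylSet]
  · intro a; simp [cylSet]
  · exact (isOpen_Iio.preimage continuous_fst).inter (hV.preimage (by fun_prop))
  · intro a; simp [cylSet]
  · intro a; simp [cylSet]
  · exact Set.disjoint_left.mpr fun q h1 h2 ↦ Set.disjoint_left.mp hd h1.2 h2.2

theorem endSeparated_inr_inr [T2Space C] {c c' : C} (h : c ≠ c') :
    EndSeparated g f (Sum.inr (Sum.inr c)) (Sum.inr (Sum.inr c')) := by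
  obtain ⟨U, V, hU, hV, hb, hb', hd⟩ := t2_separation h
  have hf := f.map.continuous
  refine ⟨cylSet ∅ {q | 0 < q.1 ∧ f.map q.2 ∈ U} U, cylSet ∅ {q | 0 < q.1 ∧ f.map q.2 ∈ V} V,
    ⟨isOpen_cylSet isOpen_empty ?_ hU, ?_, ?_⟩, ⟨isOpen_cylSet isOpen_empty ?_ hV, ?_, ?_⟩,
    hb, hb', disjoint_cylSet disjoint_bot_left ?_ hd⟩
  · exact (isOpen_Ioi.preimage continuous_fst).inter (hU.preimage (by fun_prop))
  · intro a; simp [cylSet]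
  · intro a; simp [cylSet]
  · exact (isOpen_Ioi.preimage continuous_fst).inter (hV.preimage (by fun_prop))
  · intro a; simp [cylSet]
  · intro a; simp [cylSet]
  · exact Set.disjoint_left.mpr fun q h1 h2 ↦ Set.disjoint_left.mp hd h1.2 h2.2

theorem endSeparated_cyl_cyl [T2Space A] {q q' : I × A} (h : q ≠ q') (h0 : 0 < q.1)
    (h1 : q.1 < 1) (h0' : 0 < q'.1) (h1' : q'.1 < 1) :
    EndSeparated g f (Sum.inr (Sum.inl q)) (Sum.inr (Sum.inl q')) := by
  obtain ⟨U, V, hU, hV, hb, hb', hd⟩ := t2_separation h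
  have ho : IsOpen {q : I × A | 0 < q.1 ∧ q.1 < 1} :=
    (isOpen_Ioi.preimage continuous_fst).inter (isOpen_Iio.preimage continuous_fst)
  refine ⟨cylSet ∅ ({q | 0 < q.1 ∧ q.1 < 1} ∩ U) ∅, cylSet ∅ ({q | 0 < q.1 ∧ q.1 < 1} ∩ V) ∅,
    ⟨isOpen_cylSet isOpen_empty (ho.inter hU) isOpen_empty, ?_, ?_⟩,
    ⟨isOpen_cylSet isOpen_empty (ho.inter hV) isOpen_empty, ?_, ?_⟩,
    ⟨⟨h0, h1⟩, hb⟩, ⟨⟨h0', h1'⟩, hb'⟩, disjoint_cylSet disjoint_bot_left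
      (hd.mono Set.inter_subset_right Set.inter_subset_right) disjoint_bot_left⟩ <;>
  · intro a; simp [cylSet]

/-- The height function on the double mapping cylinder. -/
def cylHeight : B ⊕ ((I × A) ⊕ C) → I := Sum.elim (fun _ ↦ 0) (Sum.elim Prod.fst fun _ ↦ 1)

/-- Height is compatible with the identifications at both ends, so the sets below and above an
intermediate height are saturated. -/
theorem endSeparated_of_height {x y : B ⊕ ((I × A) ⊕ C)} (h : cylHeight x < cylHeight y) :
    EndSeparated g f x y := by
  have hc : Continuous (cylHeight (A := A) (B := B) (C := C)) :=
    continuous_const.sumElim (continuous_fst.sumElim continuous_const)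
  obtain ⟨s, h1, h2⟩ := exists_between h
  exact ⟨cylHeight ⁻¹' Set.Iio s, cylHeight ⁻¹' Set.Ioi s,
    ⟨isOpen_Iio.preimage hc, fun _ ↦ Iff.rfl, fun _ ↦ Iff.rfl⟩,
    ⟨isOpen_Ioi.preimage hc, fun _ ↦ Iff.rfl, fun _ ↦ Iff.rfl⟩, h1, h2,
    Set.disjoint_left.mpr fun w h3 h4 ↦ lt_asymm (a := cylHeight w) h3 h4⟩

theorem exists_cyl_normal_form (x : B ⊕ ((I × A) ⊕ C)) :
    ∃ x', Quot.mk (EndRel g f) x = Quot.mk _ x' ∧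
      (∀ U, IsEndSaturated g f U → (x ∈ U ↔ x' ∈ U)) ∧
      ((∃ b, x' = Sum.inl b) ∨ (∃ q : I × A, 0 < q.1 ∧ q.1 < 1 ∧ x' = Sum.inr (Sum.inl q)) ∨
        ∃ c, x' = Sum.inr (Sum.inr c)) := by
  rcases x with b | ⟨t, a⟩ | c
  · exact ⟨_, rfl, fun _ _ ↦ Iff.rfl, Or.inl ⟨b, rfl⟩⟩
  · rcases eq_or_ne t 0 with rfl | h0
    · exact ⟨_, Quot.sound (EndRel.left a), fun U hU ↦ hU.left a, Or.inl ⟨_, rfl⟩⟩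
    rcases eq_or_ne t 1 with rfl | h1
    · exact ⟨_, Quot.sound (EndRel.right a), fun U hU ↦ hU.right a, Or.inr (Or.inr ⟨_, rfl⟩)⟩
    · exact ⟨_, rfl, fun _ _ ↦ Iff.rfl,
        Or.inr (Or.inl ⟨_, unitInterval.pos_iff_ne_zero.mpr h0,
          unitInterval.lt_one_iff_ne_one.mpr h1, rfl⟩)⟩
  · exact ⟨_, rfl, fun _ _ ↦ Iff.rfl, Or.inr (Or.inr ⟨c, rfl⟩)⟩

/-- Different points of the unreduced double mapping cylinder are separated. -/
theorem endSeparated_or [T2Space A] [T2Space B] [T2Space C] (x y : B ⊕ ((I × A) ⊕ C)) :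
    Quot.mk (EndRel g f) x = Quot.mk _ y ∨ EndSeparated g f x y := by
  obtain ⟨x', hx, hxU, hx'⟩ := exists_cyl_normal_form (g := g) (f := f) x
  obtain ⟨y', hy, hyU, hy'⟩ := exists_cyl_normal_form (g := g) (f := f) y
  have key : x' = y' ∨ EndSeparated g f x' y' := by
    rcases hx' with ⟨b, rfl⟩ | ⟨q, h0, h1, rfl⟩ | ⟨c, rfl⟩ <;>
      rcases hy' with ⟨b', rfl⟩ | ⟨q', h0', h1', rfl⟩ | ⟨c', rfl⟩
    · exact (eq_or_ne b b').imp (congrArg _) endSeparated_inl_inl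
    · exact Or.inr (endSeparated_of_height h0')
    · exact Or.inr (endSeparated_of_height zero_lt_one)
    · exact Or.inr (EndSeparated.symm (endSeparated_of_height h0))
    · exact (eq_or_ne q q').imp (congrArg fun q ↦ Sum.inr (Sum.inl q))
        fun h ↦ endSeparated_cyl_cyl h h0 h1 h0' h1'
    · exact Or.inr (endSeparated_of_height h1)
    · exact Or.inr (EndSeparated.symm (endSeparated_of_height zero_lt_one))
    · exact Or.inr (EndSeparated.symm (endSeparated_of_height h1'))
    · exact (eq_or_ne c c').imp (congrArg fun c ↦ Sum.inr (Sum.inr c)) endSeparated_inr_inr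
  refine key.imp (fun h ↦ by rw [hx, hy, h]) ?_
  rintro ⟨U, V, hU, hV, h1, h2, hd⟩
  exact ⟨U, V, hU, hV, (hxU U hU).mpr h1, (hyU V hV).mpr h2, hd⟩

theorem cylRel_mk_eq {x y : B ⊕ ((I × A) ⊕ C)}
    (h : Quot.mk (EndRel g f) x = Quot.mk _ y) : Quot.mk (CylRel g f) x = Quot.mk _ y := by
  refine congrArg (Quot.lift (Quot.mk (CylRel g f)) ?_) h
  rintro _ _ (a | a)
  · exact Quot.sound (CylRel.left a)
  · exact Quot.sound (CylRel.right a)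

/-- The unreduced double mapping cylinder of Hausdorff spaces is Hausdorff. -/
theorem t2Space_quot_endRel [T2Space A] [T2Space B] [T2Space C] :
    T2Space (Quot (EndRel g f)) := by
  refine t2Space_quot fun x y hxy ↦ ?_
  obtain ⟨U, V, hU, hV, hx, hy, hd⟩ := (endSeparated_or x y).resolve_left hxy
  refine ⟨U, V, hU.isOpen, hV.isOpen, ?_, ?_, hx, hy, hd⟩
  · rintro _ _ (a | a)
    exacts [hU.left a, hU.right a]
  · rintro _ _ (a | a)
    exacts [hV.left a, hV.right a]

theorem IsEndSaturated.inter {U V : Set (B ⊕ ((I × A) ⊕ C))} (hU : IsEndSaturated g f U)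
    (hV : IsEndSaturated g f V) : IsEndSaturated g f (U ∩ V) :=
  ⟨hU.isOpen.inter hV.isOpen, fun a ↦ and_congr (hU.left a) (hV.left a),
    fun a ↦ and_congr (hU.right a) (hV.right a)⟩

theorem IsEndSaturated.union {U V : Set (B ⊕ ((I × A) ⊕ C))} (hU : IsEndSaturated g f U)
    (hV : IsEndSaturated g f V) : IsEndSaturated g f (U ∪ V) :=
  ⟨hU.isOpen.union hV.isOpen, fun a ↦ or_congr (hU.left a) (hV.left a),
    fun a ↦ or_congr (hU.right a) (hV.right a)⟩

theorem mk_cyl_pt (t : I) :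
    Quot.mk (CylRel g f) (Sum.inr (Sum.inl (t, A.pt))) = Quot.mk _ (Sum.inl B.pt) :=
  Quot.sound (CylRel.base t)

/-- The arc over the base point is compact, so pointwise separation upgrades to separation from the
whole arc. Saturation then adds its two end points in `B` and `C`. -/
theorem endSeparated_arc [T2Space A] [T2Space B] [T2Space C] {x : B ⊕ ((I × A) ⊕ C)}
    (hx : Quot.mk (CylRel g f) x ≠ Quot.mk _ (Sum.inl B.pt)) :
    ∃ U V, IsEndSaturated g f U ∧ IsEndSaturated g f V ∧ x ∈ U ∧ cylArc ⊆ V ∧ Disjoint U V := by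
  have key : ∃ U V, IsEndSaturated g f U ∧ IsEndSaturated g f V ∧ x ∈ U ∧
      (∀ t ∈ (Set.univ : Set I), Sum.inr (Sum.inl (t, A.pt)) ∈ V) ∧ Disjoint U V := by
    refine isCompact_univ.induction_on (p := fun s : Set I ↦ ∃ U V, IsEndSaturated g f U ∧
      IsEndSaturated g f V ∧ x ∈ U ∧ (∀ t ∈ s, Sum.inr (Sum.inl (t, A.pt)) ∈ V) ∧ Disjoint U V)
      ?_ ?_ ?_ ?_
    · exact ⟨Set.univ, ∅, ⟨isOpen_univ, by simp, by simp⟩, ⟨isOpen_empty, by simp, by simp⟩,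
        trivial, by simp, disjoint_bot_right⟩
    · rintro s t hst ⟨U, V, hU, hV, hxU, hs, hd⟩
      exact ⟨U, V, hU, hV, hxU, fun u hu ↦ hs u (hst hu), hd⟩
    · rintro s t ⟨U, V, hU, hV, hxU, hs, hd⟩ ⟨U', V', hU', hV', hxU', hs', hd'⟩
      refine ⟨U ∩ U', V ∪ V', hU.inter hU', hV.union hV', ⟨hxU, hxU'⟩, ?_, ?_⟩
      · rintro u (hu | hu)
        · exact Or.inl (hs u hu)
        · exact Or.inr (hs' u hu)
      · exact Set.disjoint_union_right.mpr
          ⟨hd.mono_left Set.inter_subset_left, hd'.mono_left Set.inter_subset_right⟩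
    · intro t _
      obtain h | ⟨U, V, hU, hV, hxU, ht, hd⟩ :=
        endSeparated_or (g := g) (f := f) x (Sum.inr (Sum.inl (t, A.pt)))
      · exact absurd ((cylRel_mk_eq h).trans (mk_cyl_pt t)) hx
      · refine ⟨(fun s : I ↦ (Sum.inr (Sum.inl (s, A.pt)) : B ⊕ ((I × A) ⊕ C))) ⁻¹' V,
          mem_nhdsWithin_of_mem_nhds ((hV.isOpen.preimage (by fun_prop)).mem_nhds ht),
          U, V, hU, hV, hxU, fun _ h ↦ h, hd⟩
  obtain ⟨U, V, hU, hV, hxU, hV', hd⟩ := key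
  refine ⟨U, V, hU, hV, hxU, ?_, hd⟩
  rintro w (rfl | ⟨t, rfl⟩ | rfl)
  · rw [← g.map_pt]
    exact (hV.left _).mp (hV' 0 trivial)
  · exact hV' t trivial
  · rw [← f.map_pt]
    exact (hV.right _).mp (hV' 1 trivial)

theorem IsEndSaturated.saturated {U : Set (B ⊕ ((I × A) ⊕ C))} (hU : IsEndSaturated g f U)
    (h : cylArc ⊆ U ∨ Disjoint U cylArc) : ∀ a b, CylRel g f a b → (a ∈ U ↔ b ∈ U) := by
  rintro _ _ (a | a | t)
  · exact hU.left a
  · exact hU.right a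
  · have h1 : (Sum.inr (Sum.inl (t, A.pt)) : B ⊕ ((I × A) ⊕ C)) ∈ cylArc :=
      Or.inr (Or.inl ⟨t, rfl⟩)
    have h2 : (Sum.inl B.pt : B ⊕ ((I × A) ⊕ C)) ∈ cylArc := Or.inl rfl
    rcases h with h | h
    · exact iff_of_true (h h1) (h h2)
    · exact iff_of_false (fun h3 ↦ Set.disjoint_left.mp h h3 h1)
        fun h3 ↦ Set.disjoint_left.mp h h3 h2

/-- The reduced cylinder is the unreduced one with an arc collapsed. End-saturated sets that contain
or miss this arc are saturated, so points are separated from the arc first and from each other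
second. -/
instance t2Space_hoPushout (g : PtMap A B) (f : PtMap A C) [T2Space A] [T2Space B] [T2Space C] :
    T2Space (hoPushout g f) := by
  have hmem {x : B ⊕ ((I × A) ⊕ C)} {V : Set (B ⊕ ((I × A) ⊕ C))} (hV : IsEndSaturated g f V)
      (hV' : cylArc ⊆ V) (hx : Quot.mk (CylRel g f) x = Quot.mk _ (Sum.inl B.pt)) : x ∈ V := by
    have h1 := congrArg (Quot.lift (· ∈ V)
      (fun a b hab ↦ propext (hV.saturated (Or.inl hV') a b hab))) hx
    exact h1.mpr (hV' (Or.inl rfl))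
  refine t2Space_quot (r := CylRel g f) fun x y hxy ↦ ?_
  by_cases hx : Quot.mk (CylRel g f) x = Quot.mk _ (Sum.inl B.pt)
  · have hy : Quot.mk (CylRel g f) y ≠ Quot.mk _ (Sum.inl B.pt) := fun h ↦ hxy (hx.trans h.symm)
    obtain ⟨U, V, hU, hV, hyU, hV', hd⟩ := endSeparated_arc hy
    exact ⟨V, U, hV.isOpen, hU.isOpen, hV.saturated (Or.inl hV'),
      hU.saturated (Or.inr (hd.mono_right hV')), hmem hV hV' hx, hyU, hd.symm⟩
  · obtain ⟨U, V, hU, hV, hxU, hV', hd⟩ := endSeparated_arc hx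
    by_cases hy : Quot.mk (CylRel g f) y = Quot.mk _ (Sum.inl B.pt)
    · exact ⟨U, V, hU.isOpen, hV.isOpen, hU.saturated (Or.inr (hd.mono_right hV')),
        hV.saturated (Or.inl hV'), hxU, hmem hV hV' hy, hd⟩
    · obtain ⟨U₁, V₁, hU₁, hV₁, hyU₁, hV₁', hd₁⟩ := endSeparated_arc hy
      obtain ⟨P, Q, hP, hQ, hxP, hyQ, hPQ⟩ :=
        (endSeparated_or x y).resolve_left fun h ↦ hxy (cylRel_mk_eq h)
      refine ⟨U ∩ P, U₁ ∩ Q, (hU.inter hP).isOpen, (hU₁.inter hQ).isOpen,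
        (hU.inter hP).saturated (Or.inr ?_), (hU₁.inter hQ).saturated (Or.inr ?_), ⟨hxU, hxP⟩,
        ⟨hyU₁, hyQ⟩, hPQ.mono Set.inter_subset_right Set.inter_subset_right⟩
      · exact (hd.mono_right hV').mono_left Set.inter_subset_left
      · exact (hd₁.mono_right hV₁').mono_left Set.inter_subset_left

end HoPushout

instance t2Space_join {A B C : PtSpace.{u}} [T2Space A] [T2Space B] [T2Space C]
    (f : PtMap A C) (g : PtMap B C) : T2Space (join f g) :=
  inferInstanceAs (T2Space (hoPushout _ _))

instance t2Space_cofibre {X Y : PtSpace.{u}} [T2Space X] [T2Space Y] (f : PtMap X Y) :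
    T2Space (cofibre f) :=
  inferInstanceAs (T2Space (hoPushout _ _))

instance t2Space_sectionalFatWedge {E B : PtSpace.{u}} [T2Space E] [T2Space B] (p : PtMap E B) :
    (n : ℕ) → T2Space (sectionalFatWedge p n).1
  | 0 => inferInstanceAs (T2Space E)
  | n + 1 => by
    have := t2Space_sectionalFatWedge p n
    exact inferInstanceAs (T2Space (join (prodMap (sectionalFatWedge p n).2 (PtMap.id B))
      (prodMap (PtMap.id (power B n)) p)))

/-! ### Pointed homotopies -/

section PointedHomotopies

variable {X Y Z : PtSpace.{u}}

@[ext]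
theorem PtMap.ext {f g : PtMap X Y} (h : ∀ x, f.map x = g.map x) : f = g := by
  obtain ⟨f, _⟩ := f
  obtain ⟨g, _⟩ := g
  congr
  exact ContinuousMap.ext h

theorem PtHomotopic.refl (f : PtMap X Y) : PtHomotopic f f :=
  ContinuousMap.HomotopicRel.refl f.map

theorem PtHomotopic.symm {f g : PtMap X Y} (h : PtHomotopic f g) : PtHomotopic g f :=
  h.map PtHomotopy.symm

theorem PtHomotopic.trans {f g h : PtMap X Y} (h₁ : PtHomotopic f g) (h₂ : PtHomotopic g h) :
    PtHomotopic f h :=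
  h₁.elim fun H ↦ h₂.elim fun K ↦ ⟨PtHomotopy.trans H K⟩

theorem PtHomotopic.postcomp {f g : PtMap X Y} (h : PtHomotopic f g) (k : PtMap Y Z) :
    PtHomotopic (k.comp f) (k.comp g) :=
  h.map fun H ↦ PtHomotopy.postcomp H k

theorem PtHomotopic.precomp {f g : PtMap Y Z} (h : PtHomotopic f g) (k : PtMap X Y) :
    PtHomotopic (f.comp k) (g.comp k) :=
  h.map fun H ↦ PtHomotopy.precomp H k

/-- A pointed homotopy from a function with the required properties. -/
theorem PtHomotopic.of_fun {f g : PtMap X Y} (F : I × X → Y) (hF : Continuous F)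
    (h0 : ∀ x, F (0, x) = f.map x) (h1 : ∀ x, F (1, x) = g.map x)
    (hpt : ∀ t, F (t, X.pt) = Y.pt) : PtHomotopic f g :=
  ⟨{ toFun := F
     continuous_toFun := hF
     map_zero_left := h0
     map_one_left := h1
     prop' := fun t x hx ↦ by
      rw [Set.mem_singleton_iff] at hx
      subst hx
      exact (hpt t).trans f.map_pt.symm }⟩

theorem PtHomotopy.apply_pt {f g : PtMap X Y} (H : PtHomotopy f g) (t : I) :
    H (t, X.pt) = Y.pt :=
  (H.eq_fst t (Set.mem_singleton _)).trans f.map_pt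

theorem PtMap.comp_const (f : PtMap Y Z) : f.comp (PtMap.const X Y) = PtMap.const X Z :=
  PtMap.ext fun _ ↦ f.map_pt

theorem IsTrivial.postcomp {f : PtMap X Y} (h : IsTrivial f) (k : PtMap Y Z) :
    IsTrivial (k.comp f) := by
  have := PtHomotopic.postcomp h k
  rwa [PtMap.comp_const] at this

theorem IsTrivial.precomp {f : PtMap Y Z} (h : IsTrivial f) (k : PtMap X Y) :
    IsTrivial (f.comp k) :=
  PtHomotopic.precomp h k

theorem IsTrivial.congr {f g : PtMap X Y} (h : IsTrivial f) (k : PtHomotopic f g) : IsTrivial g :=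
  k.symm.trans h

end PointedHomotopies

/-! ### Concatenation of families of paths -/

/-- The retraction of the real line onto the unit interval. -/
def clampI : ℝ → I := Set.projIcc 0 1 zero_le_one

@[fun_prop]
theorem continuous_clampI : Continuous clampI := continuous_projIcc

theorem clampI_of_nonpos {v : ℝ} (h : v ≤ 0) : clampI v = 0 := Set.projIcc_of_le_left _ h

theorem clampI_of_one_le {v : ℝ} (h : 1 ≤ v) : clampI v = 1 := Set.projIcc_of_right_le _ h

@[simp] theorem clampI_coe (t : I) : clampI t = t := Set.projIcc_val _ t

@[simp] theorem clampI_zero : clampI 0 = 0 := clampI_of_nonpos le_rfl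

@[simp] theorem clampI_one : clampI 1 = 1 := clampI_of_one_le le_rfl

/-- Two families of paths with the same initial points, glued to a family of paths parametrized by
the real line. -/
theorem exists_two_sided_path {A S : Type*} [TopologicalSpace A] [TopologicalSpace S]
    {P Q : I × A → S} (hP : Continuous P) (hQ : Continuous Q) (h : ∀ a, P (0, a) = Q (0, a)) :
    ∃ e : ℝ × A → S, Continuous e ∧ (∀ v a, 0 ≤ v → e (v, a) = P (clampI v, a)) ∧
      ∀ v a, v ≤ 0 → e (v, a) = Q (clampI (-v), a) := by
  refine ⟨fun w ↦ if 0 ≤ w.1 then P (clampI w.1, w.2) else Q (clampI (-w.1), w.2), ?_, ?_, ?_⟩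
  · refine Continuous.if_le (by fun_prop) (by fun_prop) continuous_const continuous_fst ?_
    rintro ⟨v, a⟩ (rfl : (0 : ℝ) = v)
    simpa using h a
  · intro v a hv
    exact if_pos hv
  · intro v a hv
    rcases hv.eq_or_lt with rfl | hv
    · simpa using h a
    · exact if_neg hv.not_ge

/-! ### Homotopies on homotopy pushouts -/

section HoPushout

variable {A B C : PtSpace.{u}} (g : PtMap A B) (f : PtMap A C)

/-- The cylinder of the standard homotopy pushout. -/
def hoPushoutCyl (q : I × A) : hoPushout g f := Quot.mk _ (Sum.inr (Sum.inl q))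

@[fun_prop]
theorem continuous_hoPushoutCyl : Continuous (hoPushoutCyl g f) :=
  continuous_quot_mk.comp (continuous_inr.comp continuous_inl)

theorem hoPushoutCyl_zero (a : A) :
    hoPushoutCyl g f (0, a) = (hoPushoutInl g f).map (g.map a) := Quot.sound (CylRel.left a)

theorem hoPushoutCyl_one (a : A) :
    hoPushoutCyl g f (1, a) = (hoPushoutInr g f).map (f.map a) := Quot.sound (CylRel.right a)

theorem hoPushoutCyl_pt (t : I) : hoPushoutCyl g f (t, A.pt) = (hoPushout g f).pt :=
  Quot.sound (CylRel.base t)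

variable {g f}

theorem hoPushout_cases {p : hoPushout g f → Prop} (hB : ∀ b, p ((hoPushoutInl g f).map b))
    (hA : ∀ q, p (hoPushoutCyl g f q)) (hC : ∀ c, p ((hoPushoutInr g f).map c)) (w) : p w := by
  obtain ⟨b | q | c⟩ := w
  exacts [hB b, hA q, hC c]

theorem continuous_prod_sum_right {T A B V : Type*} [TopologicalSpace T] [TopologicalSpace A]
    [TopologicalSpace B] [TopologicalSpace V] {h : T × (A ⊕ B) → V}
    (hA : Continuous fun w : T × A ↦ h (w.1, Sum.inl w.2))
    (hB : Continuous fun w : T × B ↦ h (w.1, Sum.inr w.2)) : Continuous h := by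
  have h1 : Continuous (h ∘ (Homeomorph.prodSumDistrib (X := T) (Y := A) (Z := B)).symm) :=
    continuous_sum_dom.mpr ⟨hA, hB⟩
  simpa using h1.comp (Homeomorph.prodSumDistrib (X := T) (Y := A) (Z := B)).continuous

/-- A pointed homotopy on the standard homotopy pushout from homotopies on its pieces. -/
theorem exists_homotopic_of_pieces {V : PtSpace.{u}} (k : PtMap (hoPushout g f) V)
    {FB : I × B → V} {FA : I × (I × A) → V} {FC : I × C → V} (hB : Continuous FB)
    (hA : Continuous FA) (hC : Continuous FC) (hl : ∀ t a, FA (t, (0, a)) = FB (t, g.map a))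
    (hr : ∀ t a, FA (t, (1, a)) = FC (t, f.map a)) (hb : ∀ t r, FA (t, (r, A.pt)) = V.pt)
    (h0B : ∀ b, FB (0, b) = k.map ((hoPushoutInl g f).map b))
    (h0A : ∀ q, FA (0, q) = k.map (hoPushoutCyl g f q))
    (h0C : ∀ c, FC (0, c) = k.map ((hoPushoutInr g f).map c)) :
    ∃ k' : PtMap (hoPushout g f) V, PtHomotopic k k' ∧
      (∀ b, k'.map ((hoPushoutInl g f).map b) = FB (1, b)) ∧
      (∀ q, k'.map (hoPushoutCyl g f q) = FA (1, q)) ∧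
      (∀ c, k'.map ((hoPushoutInr g f).map c) = FC (1, c)) := by
  have hpt (t : I) : FB (t, B.pt) = V.pt := by rw [← g.map_pt, ← hl, hb]
  let F : I × hoPushout g f → V := fun w ↦
    Quot.lift (fun z ↦ Sum.elim (fun b ↦ FB (w.1, b)) (Sum.elim (fun q ↦ FA (w.1, q))
      (fun c ↦ FC (w.1, c))) z) (by
        rintro _ _ (a | a | t)
        · exact hl _ _
        · exact hr _ _
        · exact (hb _ _).trans (hpt _).symm) w.2
  have hF : Continuous F := by
    refine isQuotientMap_quot_mk.continuous_lift_prod_right ?_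
    exact continuous_prod_sum_right hB (continuous_prod_sum_right hA hC)
  refine ⟨⟨⟨fun w ↦ F (1, w), by fun_prop⟩, hpt 1⟩, ?_, fun _ ↦ rfl, fun _ ↦ rfl, fun _ ↦ rfl⟩
  exact PtHomotopic.of_fun F hF (hoPushout_cases h0B h0A h0C) (fun _ ↦ rfl) hpt

end HoPushout

/-! ### Pairings and covers -/

/-- A map `S × T → V` which is trivial on the wedge `S ∨ T`. -/
def TrivialOnWedge {S T V : PtSpace.{u}} (μ : PtMap (prod S T) V) : Prop :=
  (∀ t, μ.map (CompactCoherentification.mk (S × T) (S.pt, t)) = V.pt) ∧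
    ∀ s, μ.map (CompactCoherentification.mk (S × T) (s, T.pt)) = V.pt

section Cover

variable {A B C : PtSpace.{u}} {g : PtMap A B} {f : PtMap A C}

/-- A map on a homotopy pushout which is trivial on the left end is homotopic to a map which is
strictly trivial on the left half. -/
theorem exists_trivial_on_left_half {S : PtSpace.{u}} {x : PtMap (hoPushout g f) S}
    (h : IsTrivial (x.comp (hoPushoutInl g f))) :
    ∃ x', PtHomotopic x x' ∧ (∀ b, x'.map ((hoPushoutInl g f).map b) = S.pt) ∧
      ∀ (r : I) a, (r : ℝ) ≤ 1 / 2 → x'.map (hoPushoutCyl g f (r, a)) = S.pt := by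
  obtain ⟨F⟩ := h
  have hx := x.map.continuous
  have hg := g.map.continuous
  have hF0 (b) : F (0, b) = x.map ((hoPushoutInl g f).map b) := F.apply_zero b
  have hF1 (b) : F (1, b) = S.pt := F.apply_one b
  -- For each `a`, positive parameters follow `x` along the cylinder and negative ones continue past
  -- the left end along the null-homotopy.
  obtain ⟨e, he, hpos, hneg⟩ := exists_two_sided_path (A := A) (S := S)
    (P := fun w ↦ x.map (hoPushoutCyl g f w)) (Q := fun w ↦ F (w.1, g.map w.2)) (by fun_prop)
    (by fun_prop) (fun a ↦ by rw [hF0, hoPushoutCyl_zero])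
  have hept (v : ℝ) : e (v, A.pt) = S.pt := by
    rcases le_total 0 v with hv | hv
    · rw [hpos _ _ hv, hoPushoutCyl_pt, x.map_pt]
    · rw [hneg _ _ hv, g.map_pt, PtHomotopy.apply_pt]
  -- The parameter `max (-t) (r - 3t(1 - r))` equals `r` at `t = 0`, `-t` at the left end and `1` at
  -- the right end. At `t = 1` it is `max (-1) (4r - 3)`, hence `-1` for `r ≤ 1/2`, where the path
  -- has reached the base point.
  have hl (t : I) (a : A) : e (max (-(t : ℝ)) (((0 : I) : ℝ) - 3 * t * (1 - ((0 : I) : ℝ))), a) =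
      F (t, g.map a) := by
    have h1 : max (-(t : ℝ)) (((0 : I) : ℝ) - 3 * t * (1 - ((0 : I) : ℝ))) = -t := by
      simp only [Set.Icc.coe_zero]
      exact max_eq_left (by linarith [t.2.1])
    rw [h1, hneg _ _ (by linarith [t.2.1]), neg_neg, clampI_coe]
  have hr (t : I) (a : A) : e (max (-(t : ℝ)) (((1 : I) : ℝ) - 3 * t * (1 - ((1 : I) : ℝ))), a) =
      x.map ((hoPushoutInr g f).map (f.map a)) := by
    have h1 : max (-(t : ℝ)) (((1 : I) : ℝ) - 3 * t * (1 - ((1 : I) : ℝ))) = 1 := by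
      simp only [Set.Icc.coe_one, sub_self, mul_zero, sub_zero]
      exact max_eq_right (by linarith [t.2.1])
    rw [h1, hpos _ _ zero_le_one, clampI_one, hoPushoutCyl_one]
  have h0 (q : I × A) : e (max (-((0 : I) : ℝ)) (q.1 - 3 * ((0 : I) : ℝ) * (1 - q.1)), q.2) =
      x.map (hoPushoutCyl g f q) := by
    have h1 : max (-((0 : I) : ℝ)) (q.1 - 3 * ((0 : I) : ℝ) * (1 - q.1)) = q.1 := by
      simp [q.1.2.1]
    rw [h1, hpos _ _ q.1.2.1, clampI_coe]
  obtain ⟨x', hxx', hB, hA, -⟩ := exists_homotopic_of_pieces x (FB := F)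
    (FA := fun w : I × (I × A) ↦
      e (max (-(w.1 : ℝ)) (w.2.1 - 3 * (w.1 : ℝ) * (1 - w.2.1)), w.2.2))
    (FC := fun w ↦ x.map ((hoPushoutInr g f).map w.2)) (by fun_prop) (by fun_prop)
    (by fun_prop) hl hr (fun _ _ ↦ hept _) hF0 h0 fun _ ↦ rfl
  refine ⟨x', hxx', fun b ↦ (hB b).trans (hF1 b), fun r a hr ↦ ?_⟩
  have h1 : max (-((1 : I) : ℝ)) (r - 3 * ((1 : I) : ℝ) * (1 - r)) = -1 := by
    simp only [Set.Icc.coe_one]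
    exact max_eq_left (by linarith)
  rw [hA, h1, hneg _ _ (by norm_num)]
  simp [hF1]

variable (g f)

/-- The canonical homotopy of the standard homotopy pushout. -/
def hoPushoutHomotopy :
    PtHomotopy ((hoPushoutInl g f).comp g) ((hoPushoutInr g f).comp f) where
  toFun := hoPushoutCyl g f
  continuous_toFun := continuous_hoPushoutCyl g f
  map_zero_left := hoPushoutCyl_zero g f
  map_one_left := hoPushoutCyl_one g f
  prop' t x hx := by
    rw [Set.mem_singleton_iff] at hx
    subst hx
    exact (hoPushoutCyl_pt g f t).trans ((hoPushoutInl g f).comp g).map_pt.symm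

/-- The interchange of the two legs of a homotopy pushout. -/
def hoPushoutSwap : PtMap (hoPushout g f) (hoPushout f g) :=
  coWhisker (i := hoPushoutInr f g) (j := hoPushoutInl f g) (hoPushoutHomotopy f g).symm

theorem hoPushoutSwap_swap :
    (hoPushoutSwap f g).comp (hoPushoutSwap g f) = PtMap.id (hoPushout g f) := by
  ext w
  refine hoPushout_cases (g := g) (f := f)
    (p := fun w ↦ ((hoPushoutSwap f g).comp (hoPushoutSwap g f)).map w = w)
    (fun b ↦ rfl) ?_ (fun c ↦ rfl) w
  rintro ⟨r, a⟩
  change hoPushoutCyl g f (σ (σ r), a) = hoPushoutCyl g f (r, a)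
  rw [unitInterval.symm_symm]

variable {g f}

theorem exists_trivial_on_right_half {S : PtSpace.{u}} {x : PtMap (hoPushout g f) S}
    (h : IsTrivial (x.comp (hoPushoutInr g f))) :
    ∃ x', PtHomotopic x x' ∧ (∀ c, x'.map ((hoPushoutInr g f).map c) = S.pt) ∧
      ∀ (r : I) a, 1 / 2 ≤ (r : ℝ) → x'.map (hoPushoutCyl g f (r, a)) = S.pt := by
  obtain ⟨y, hy, hyB, hyA⟩ := exists_trivial_on_left_half (g := f) (f := g)
    (x := x.comp (hoPushoutSwap f g)) h
  refine ⟨y.comp (hoPushoutSwap g f), ?_, hyB, fun r a hr ↦ hyA (σ r) a ?_⟩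
  · have h1 := hy.precomp (hoPushoutSwap g f)
    have h2 : (x.comp (hoPushoutSwap f g)).comp (hoPushoutSwap g f) = x :=
      congrArg x.comp (hoPushoutSwap_swap g f)
    rwa [h2] at h1
  · rw [unitInterval.coe_symm_eq]
    linarith

theorem PtHomotopic.prodLift {X Y Z : PtSpace.{u}} {f f' : PtMap X Y} {g g' : PtMap X Z}
    (hf : PtHomotopic f f') (hg : PtHomotopic g g') :
    PtHomotopic (prodLift f g) (prodLift f' g') := by
  obtain ⟨F⟩ := hf
  obtain ⟨G⟩ := hg
  refine PtHomotopic.of_fun (fun w ↦ CompactCoherentification.mk (Y × Z) (F w, G w))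
    (continuous_toK (Y := Y × Z) (F.continuous.prodMk G.continuous)) (fun x ↦ ?_) (fun x ↦ ?_)
    fun t ↦ ?_
  · rw [F.apply_zero, G.apply_zero]; rfl
  · rw [F.apply_one, G.apply_one]; rfl
  · rw [PtHomotopy.apply_pt, PtHomotopy.apply_pt]; rfl

/-- The product of a map which is trivial on `B` and a map which is trivial on `C` is trivial on
the homotopy pushout of `B ← A → C`. -/
theorem isTrivial_pairing_of_cover {S T V : PtSpace.{u}} {μ : PtMap (prod S T) V}
    (hμ : TrivialOnWedge μ) {x : PtMap (hoPushout g f) S} {y : PtMap (hoPushout g f) T}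
    (hx : IsTrivial (x.comp (hoPushoutInl g f))) (hy : IsTrivial (y.comp (hoPushoutInr g f))) :
    IsTrivial (μ.comp (prodLift x y)) := by
  -- After the two homotopies every point lies in the half where `x'` is constant or in the half
  -- where `y'` is, so `(x', y')` lands in the wedge.
  obtain ⟨x', hx', hxB, hxA⟩ := exists_trivial_on_left_half hx
  obtain ⟨y', hy', hyC, hyA⟩ := exists_trivial_on_right_half hy
  have h1 := (hx'.prodLift hy').postcomp μ
  have h2 : μ.comp (prodLift x' y') = PtMap.const _ _ := by
    ext w
    change μ.map (CompactCoherentification.mk (S × T) (x'.map w, y'.map w)) = V.pt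
    refine hoPushout_cases (g := g) (f := f)
      (p := fun w ↦ μ.map (CompactCoherentification.mk (S × T) (x'.map w, y'.map w)) = V.pt)
      (fun b ↦ ?_) ?_ (fun c ↦ ?_) w
    · rw [hxB, hμ.1]
    · rintro ⟨r, a⟩
      rcases le_total (r : ℝ) (1 / 2) with hr | hr
      · rw [hxA r a hr, hμ.1]
      · rw [hyA r a hr, hμ.2]
    · rw [hyC, hμ.2]
  rwa [h2] at h1

end Cover

/-! ### The pairing of smash powers -/

/-- The first projection. -/
def prodFst (X Y : PtSpace.{u}) : PtMap (prod X Y) X where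
  map := ⟨fun z ↦ ((CompactCoherentification.mk (X × Y)).symm z).1,
    continuous_fst.comp CompactCoherentification.continuous_mk_symm⟩
  map_pt := rfl

/-- The second projection. -/
def prodSnd (X Y : PtSpace.{u}) : PtMap (prod X Y) Y where
  map := ⟨fun z ↦ ((CompactCoherentification.mk (X × Y)).symm z).2,
    continuous_snd.comp CompactCoherentification.continuous_mk_symm⟩
  map_pt := rfl

/-- The identification `Q ^ (n + 1) × Q ^ (m + 1) → Q ^ (n + m + 2)`. -/
def appendPower (Q : PtSpace.{u}) (n : ℕ) :
    (m : ℕ) → PtMap (prod (power Q n) (power Q m)) (power Q (n + m + 1))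
  | 0 => PtMap.id _
  | m + 1 => prodLift
      ((appendPower Q n m).comp (prodLift (prodFst _ _) ((prodFst _ Q).comp (prodSnd _ _))))
      ((prodSnd (power Q m) Q).comp (prodSnd _ _))

theorem appendPower_mem_fatWedge {Q : PtSpace.{u}} {n m : ℕ} (a : power Q n) (b : power Q m) :
    (appendPower Q n m).map (CompactCoherentification.mk (power Q n × power Q m) (a, b)) ∈
      fatWedge Q (n + m + 1) ↔ a ∈ fatWedge Q n ∨ b ∈ fatWedge Q m := by
  induction m with
  | zero => rfl
  | succ m ih => exact (or_congr_left (ih b.1)).trans or_assoc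

theorem appendPower_diag {Q : PtSpace.{u}} (n m : ℕ) (b : Q) :
    (appendPower Q n m).map (CompactCoherentification.mk (power Q n × power Q m)
      ((diag Q n).map b, (diag Q m).map b)) = (diag Q (n + m + 1)).map b := by
  induction m with
  | zero => rfl
  | succ m ih =>
    exact congrArg (fun a ↦ CompactCoherentification.mk (power Q (n + m + 1) × Q) (a, b)) ih

theorem pt_mem_fatWedge (Q : PtSpace.{u}) : (n : ℕ) → (power Q n).pt ∈ fatWedge Q n
  | 0 => rfl
  | _ + 1 => Or.inr rfl

/-- The projection from the power to the smash power. -/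
def smashQuot (Q : PtSpace.{u}) (n : ℕ) : PtMap (power Q n) (smashPower Q n) :=
  ⟨⟨Quot.mk _, continuous_quot_mk⟩, rfl⟩

theorem isQuotientMap_smashQuot (Q : PtSpace.{u}) (n : ℕ) :
    Topology.IsQuotientMap (smashQuot Q n).map :=
  isQuotientMap_quot_mk

theorem smashQuot_eq_pt {Q : PtSpace.{u}} {n : ℕ} {a : power Q n} (h : a ∈ fatWedge Q n) :
    (smashQuot Q n).map a = (smashPower Q n).pt :=
  Quot.sound ⟨h, pt_mem_fatWedge Q n⟩

/-- The function underlying the pairing of smash powers. -/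
def smashPairingFun (Q : PtSpace.{u}) (n m : ℕ) (w : smashPower Q n × smashPower Q m) :
    smashPower Q (n + m + 1) :=
  Quot.map₂ (fun a b ↦ (appendPower Q n m).map
      (CompactCoherentification.mk (power Q n × power Q m) (a, b)))
    (fun _ _ _ h ↦ ⟨(appendPower_mem_fatWedge _ _).mpr (Or.inr h.1),
      (appendPower_mem_fatWedge _ _).mpr (Or.inr h.2)⟩)
    (fun _ _ _ h ↦ ⟨(appendPower_mem_fatWedge _ _).mpr (Or.inl h.1),
      (appendPower_mem_fatWedge _ _).mpr (Or.inl h.2)⟩) w.1 w.2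

/-- The pairing of smash powers. -/
def smashPairing (Q : PtSpace.{u}) [T2Space Q] (n m : ℕ) :
    PtMap (prod (smashPower Q n) (smashPower Q m)) (smashPower Q (n + m + 1)) where
  map :=
    { toFun := fun z ↦ smashPairingFun Q n m
        ((CompactCoherentification.mk (smashPower Q n × smashPower Q m)).symm z)
      continuous_toFun :=
        -- The pairing is continuous before collapsing; it descends because both collapses are
        -- quotient maps and `Q` is Hausdorff.
        continuous_of_quotient_prod (Y₀ := power Q n) (Z₀ := power Q m) (Y := smashPower Q n)
          (Z := smashPower Q m) (p := (smashQuot Q n).map) (q := (smashQuot Q m).map)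
          (isQuotientMap_smashQuot Q n) (isQuotientMap_smashQuot Q m) (smashPairingFun Q n m)
          ((smashQuot Q (n + m + 1)).comp (appendPower Q n m)).map.continuous }
  map_pt := smashQuot_eq_pt
    ((appendPower_mem_fatWedge _ _).mpr (Or.inl (pt_mem_fatWedge Q n)))

theorem trivialOnWedge_smashPairing (Q : PtSpace.{u}) [T2Space Q] (n m : ℕ) :
    TrivialOnWedge (smashPairing Q n m) := by
  refine ⟨?_, ?_⟩
  · rintro ⟨b⟩
    exact smashQuot_eq_pt ((appendPower_mem_fatWedge _ b).mpr (Or.inl (pt_mem_fatWedge Q n)))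
  · rintro ⟨a⟩
    exact smashQuot_eq_pt ((appendPower_mem_fatWedge a _).mpr (Or.inr (pt_mem_fatWedge Q m)))

theorem smashPairing_reducedDiag (Q : PtSpace.{u}) [T2Space Q] (n m : ℕ) :
    (smashPairing Q n m).comp (prodLift (reducedDiag Q n) (reducedDiag Q m)) =
      reducedDiag Q (n + m + 1) :=
  PtMap.ext fun b ↦ congrArg (Quot.mk _) (appendPower_diag n m b)

/-! ### Maps of bounded weak category -/

/-- The composite of `u : B → Q` with the reduced diagonal `Q → Q ^ [n + 1]` is trivial. -/
def WcatLE {B Q : PtSpace.{u}} (u : PtMap B Q) (n : ℕ) : Prop :=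
  IsTrivial ((reducedDiag Q n).comp u)

theorem IsEquivalence.isTrivial_of_comp {W D S : PtSpace.{u}} {w : PtMap W D}
    (hw : IsEquivalence w) {k : PtMap D S} (h : IsTrivial (k.comp w)) : IsTrivial k := by
  obtain ⟨v, -, hv⟩ := hw
  exact (h.precomp v).congr (hv.postcomp k)

/-- The reduced diagonal with `(n + 1) + (m + 1)` factors is the pairing of two shorter ones, each
trivial on one leg. The extra `1` arises since index `k` stands for `k + 1` factors. -/
theorem WcatLE.of_isHoPushout {A B C D Q : PtSpace.{u}} [T2Space Q] {g : PtMap A B}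
    {f : PtMap A C} {i : PtMap B D} {j : PtMap C D} {H : PtHomotopy (i.comp g) (j.comp f)}
    (hH : IsHoPushout H) {u : PtMap D Q} {n m : ℕ} (hi : WcatLE (u.comp i) n)
    (hj : WcatLE (u.comp j) m) : WcatLE u (n + m + 1) := by
  refine hH.isTrivial_of_comp ?_
  have h := isTrivial_pairing_of_cover (trivialOnWedge_smashPairing Q n m)
    (x := (reducedDiag Q n).comp (u.comp (coWhisker H)))
    (y := (reducedDiag Q m).comp (u.comp (coWhisker H))) hi hj
  rw [← smashPairing_reducedDiag]
  exact h

/-! ### Weak sectional category and reduced diagonals -/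

/-- The power of a map. -/
def powerMap {B Q : PtSpace.{u}} (u : PtMap B Q) : (n : ℕ) → PtMap (power B n) (power Q n)
  | 0 => u
  | n + 1 => prodMap (powerMap u n) u

theorem powerMap_diag {B Q : PtSpace.{u}} (u : PtMap B Q) (n : ℕ) (b : B) :
    (powerMap u n).map ((diag B n).map b) = (diag Q n).map (u.map b) := by
  induction n with
  | zero => rfl
  | succ n ih =>
    exact congrArg (fun a ↦ CompactCoherentification.mk (power Q n × Q) (a, u.map b)) ih

theorem exists_extension_to_cofibre {X Y S : PtSpace.{u}} {f : PtMap X Y} {x : PtMap Y S}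
    (h : IsTrivial (x.comp f)) : ∃ r : PtMap (cofibre f) S, r.comp (toCofibre f) = x := by
  obtain ⟨H⟩ := h
  exact ⟨coWhisker (i := PtMap.const point S) (j := x) (g := PtMap.const X point) (f := f) H.symm,
    rfl⟩

/-- On `X × B` contract the first coordinate, on `Z × E` the second. Over a path `ω` of the homotopy
pullback the two contractions are blended so that at the end at least one coordinate is trivial at
every point of the path. -/
theorem isTrivial_joinMap {X Z E B S T V : PtSpace.{u}} {μ : PtMap (prod S T) V}
    (hμ : TrivialOnWedge μ) {f : PtMap X Z} {p : PtMap E B} {x : PtMap Z S} {y : PtMap B T}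
    (hx : IsTrivial (x.comp f)) (hy : IsTrivial (y.comp p)) :
    IsTrivial ((μ.comp (prodMap x y)).comp
      (joinMap (prodMap f (PtMap.id B)) (prodMap (PtMap.id Z) p))) := by
  obtain ⟨M⟩ := hx
  obtain ⟨N⟩ := hy
  set F := prodMap f (PtMap.id B)
  set G := prodMap (PtMap.id Z) p
  have hM0 (a) : M (0, a) = x.map (f.map a) := M.apply_zero a
  have hM1 (a) : M (1, a) = S.pt := M.apply_one a
  have hN0 (a) : N (0, a) = y.map (p.map a) := N.apply_zero a
  have hN1 (a) : N (1, a) = T.pt := N.apply_one a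
  have hpi := continuous_hoPullbackVal F G
  have hω0 (z : hoPullback F G) : (hoPullbackVal F G z).2.1 0 = F.map (hoPullbackVal F G z).1 :=
    ((CompactCoherentification.mk (HoPullbackSet F G)).symm z).2.1
  have hω1 (z : hoPullback F G) :
      (hoPullbackVal F G z).2.1 1 = G.map (hoPullbackVal F G z).2.2 :=
    ((CompactCoherentification.mk (HoPullbackSet F G)).symm z).2.2
  -- `e₁` follows the first coordinate of `ω` from its start, prolonged by the null-homotopy `M`;
  -- `e₂` follows the second coordinate backwards from the end, prolonged by `N`.
  obtain ⟨e₁, he₁, hpos₁, hneg₁⟩ := exists_two_sided_path (A := hoPullback F G) (S := S)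
    (P := fun w ↦ x.map ((prodFst Z B).map ((hoPullbackVal F G w.2).2.1 w.1)))
    (Q := fun w ↦ M (w.1, (prodFst X B).map (hoPullbackVal F G w.2).1)) (by fun_prop)
    (by fun_prop) (fun z ↦ by rw [hω0, hM0]; rfl)
  obtain ⟨e₂, he₂, hpos₂, hneg₂⟩ := exists_two_sided_path (A := hoPullback F G) (S := T)
    (P := fun w ↦ y.map ((prodSnd Z B).map ((hoPullbackVal F G w.2).2.1 (σ w.1))))
    (Q := fun w ↦ N (w.1, (prodSnd Z E).map (hoPullbackVal F G w.2).2.2)) (by fun_prop)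
    (by fun_prop) (fun z ↦ by rw [unitInterval.symm_zero, hω1, hN0]; rfl)
  have hept₁ (v : ℝ) : e₁ (v, (hoPullback F G).pt) = S.pt := by
    rcases le_total 0 v with hv | hv
    · rw [hpos₁ _ _ hv]; exact x.map_pt
    · rw [hneg₁ _ _ hv]; exact M.apply_pt _
  have hept₂ (v : ℝ) : e₂ (v, (hoPullback F G).pt) = T.pt := by
    rcases le_total 0 v with hv | hv
    · rw [hpos₂ _ _ hv]; exact y.map_pt
    · rw [hneg₂ _ _ hv]; exact N.apply_pt _
  let mk : S × T → prod S T := CompactCoherentification.mk (S × T)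
  have hmk {K : Type u} [TopologicalSpace K] [CompactlyCoherentSpace K] {a : K → S} {b : K → T}
      (ha : Continuous a) (hb : Continuous b) : Continuous fun k ↦ μ.map (mk (a k, b k)) :=
    μ.map.continuous.comp (continuous_toK (Y := S × T) (ha.prodMk hb))
  -- `a₁` is `r` at `t = 0`, `-t` at `r = 0` and `1` at `r = 1`; at `t = 1` it is `-1` for all `r ≤
  -- 1/2`. `a₂` is its mirror image under `r ↦ 1 - r`, so at `t = 1` one of the two is `-1` for
  -- every `r`.
  let a₁ : I → I → ℝ := fun t r ↦ (r : ℝ) - min 1 (2 * (1 - (r : ℝ))) * t * (1 + r)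
  let a₂ : I → I → ℝ := fun t r ↦ 1 - ((r : ℝ) + min 1 (2 * (r : ℝ)) * t * (2 - r))
  have hl (t : I) (z) : μ.map (mk (e₁ (a₁ t 0, z), e₂ (a₂ t 0, z))) =
      μ.map (mk (M (t, (prodFst X B).map (hoPullbackVal F G z).1),
        y.map ((prodSnd X B).map (hoPullbackVal F G z).1))) := by
    have h1 : a₁ t 0 = -t := by simp [a₁]
    have h2 : a₂ t 0 = 1 := by simp [a₂]
    rw [h1, h2, hneg₁ _ _ (by linarith [t.2.1]), hpos₂ _ _ zero_le_one, neg_neg, clampI_coe,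
      clampI_one, unitInterval.symm_one, hω0]
    rfl
  have hr (t : I) (z) : μ.map (mk (e₁ (a₁ t 1, z), e₂ (a₂ t 1, z))) =
      μ.map (mk (x.map ((prodFst Z E).map (hoPullbackVal F G z).2.2),
        N (t, (prodSnd Z E).map (hoPullbackVal F G z).2.2))) := by
    have h1 : a₁ t 1 = 1 := by simp [a₁]
    have h2 : a₂ t 1 = -t := by
      simp only [a₂, Set.Icc.coe_one]
      rw [min_eq_left (by norm_num)]
      ring
    rw [h1, h2, hpos₁ _ _ zero_le_one, hneg₂ _ _ (by linarith [t.2.1]), neg_neg, clampI_coe,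
      clampI_one, hω1]
    rfl
  have h0 (q : I × hoPullback F G) : μ.map (mk (e₁ (a₁ 0 q.1, q.2), e₂ (a₂ 0 q.1, q.2))) =
      μ.map ((prodMap x y).map ((hoPullbackVal F G q.2).2.1 q.1)) := by
    have h1 : a₁ 0 q.1 = q.1 := by simp [a₁]
    have h2 : a₂ 0 q.1 = σ q.1 := by simp [a₂]
    rw [h1, h2, hpos₁ _ _ q.1.2.1, hpos₂ _ _ (σ q.1).2.1, clampI_coe, clampI_coe,
      unitInterval.symm_symm]
    rfl
  have h1 (q : I × hoPullback F G) :
      μ.map (mk (e₁ (a₁ 1 q.1, q.2), e₂ (a₂ 1 q.1, q.2))) = V.pt := by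
    obtain ⟨r, z⟩ := q
    rcases le_total (r : ℝ) (1 / 2) with hr | hr
    · have h1 : a₁ 1 r = -1 := by
        simp only [a₁, Set.Icc.coe_one]
        rw [min_eq_left (by linarith)]
        ring
      simp only
      rw [h1, hneg₁ _ _ (by norm_num), neg_neg, clampI_one, hM1]
      exact hμ.1 _
    · have h2 : a₂ 1 r = -1 := by
        simp only [a₂, Set.Icc.coe_one]
        rw [min_eq_left (by linarith)]
        ring
      simp only
      rw [h2, hneg₂ _ _ (by norm_num), neg_neg, clampI_one, hN1]
      exact hμ.2 _
  obtain ⟨k, hk, hkB, hkA, hkC⟩ := exists_homotopic_of_pieces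
    (g := hoPullbackFst F G) (f := hoPullbackSnd F G) ((μ.comp (prodMap x y)).comp (joinMap F G))
    (FB := fun w ↦ μ.map (mk (M (w.1, (prodFst X B).map w.2), y.map ((prodSnd X B).map w.2))))
    (FA := fun w ↦ μ.map (mk (e₁ (a₁ w.1 w.2.1, w.2.2), e₂ (a₂ w.1 w.2.1, w.2.2))))
    (FC := fun w ↦ μ.map (mk (x.map ((prodFst Z E).map w.2), N (w.1, (prodSnd Z E).map w.2))))
    (hmk (by fun_prop) (by fun_prop)) (hmk (by fun_prop) (by fun_prop))
    (hmk (by fun_prop) (by fun_prop)) hl hr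
    (fun t r ↦ by rw [hept₁, hept₂]; exact hμ.1 _)
    (fun b ↦ by rw [hM0]; rfl) h0 (fun c ↦ by rw [hN0]; rfl)
  refine hk.trans ?_
  have : k = PtMap.const _ _ := by
    refine PtMap.ext (hoPushout_cases (fun b ↦ ?_) (fun q ↦ ?_) fun c ↦ ?_)
    · rw [hkB, hM1]; exact hμ.1 _
    · rw [hkA, h1]; rfl
    · rw [hkC, hN1]; exact hμ.2 _
  rw [this]
  exact PtHomotopic.refl _

/-- The inductive step is `isTrivial_joinMap` for the smash pairing with one extra factor, as
`κ_(n+1)` is the join of `κ_n × id` and `id × p`. -/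
theorem isTrivial_smashQuot_powerMap {E B Q : PtSpace.{u}} [T2Space Q] {p : PtMap E B}
    {u : PtMap B Q} (h : IsTrivial (u.comp p)) (n : ℕ) :
    IsTrivial (((smashQuot Q n).comp (powerMap u n)).comp (sectionalFatWedge p n).2) := by
  induction n with
  | zero => exact h.postcomp (smashQuot Q 0)
  | succ n ih =>
    exact isTrivial_joinMap (p := p) (y := (smashQuot Q 0).comp u)
      (trivialOnWedge_smashPairing Q n 0) ih (h.postcomp (smashQuot Q 0))

/-- If `p` has weak sectional category at most `n`, then so does any map which is trivial
on `p`. -/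
theorem WcatLE.of_isTrivial_comp {E B Q : PtSpace.{u}} [T2Space Q] {p : PtMap E B} {n : ℕ}
    (hp : IsTrivial ((toCofibre (sectionalFatWedge p n).2).comp (diag B n)))
    {u : PtMap B Q} (h : IsTrivial (u.comp p)) : WcatLE u n := by
  -- The reduced diagonal of `Q` along `u` then factors as `B → C_(κ_n)`, trivial by hypothesis,
  -- followed by `r`.
  obtain ⟨r, hr⟩ := exists_extension_to_cofibre (isTrivial_smashQuot_powerMap h n)
  have h1 : r.comp ((toCofibre (sectionalFatWedge p n).2).comp (diag B n)) =
      (reducedDiag Q n).comp u := by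
    change (r.comp (toCofibre (sectionalFatWedge p n).2)).comp (diag B n) = _
    rw [hr]
    exact PtMap.ext fun b ↦ congrArg (Quot.mk _) (powerMap_diag u n b)
  rw [WcatLE, ← h1]
  exact hp.postcomp r

/-! ### Free and pointed triviality -/

/-- A pointed map on a well-pointed space which is freely homotopic to a constant map is
trivial. -/
theorem isTrivial_of_homotopic_const {B : WPSpace.{u}} {Y : PtSpace.{u}} {f : PtMap B Y} {y : Y}
    (h : f.map.Homotopic (ContinuousMap.const _ y)) : IsTrivial f := by
  obtain ⟨F⟩ := h
  have hF0 (b) : F (0, b) = f.map b := F.apply_zero b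
  have hF1 (b) : F (1, b) = y := F.apply_one b
  -- Read from `1` to `-1`, the path goes from `f b` to `y` and back along the track of the base
  -- point, so it ends at `Y.pt`. Over `B.pt` it is a track followed by its reverse.
  obtain ⟨e, he, hpos, hneg⟩ := exists_two_sided_path (A := B.toPtSpace) (S := Y)
    (P := fun w ↦ F (σ w.1, w.2)) (Q := fun w ↦ F (σ w.1, B.pt)) (by fun_prop) (by fun_prop)
    (fun b ↦ by rw [unitInterval.symm_zero, hF1, hF1])
  let φ : C(B.toPtSpace, C(I, Y)) := ContinuousMap.curry
    ⟨fun w : B.toPtSpace × I ↦ e (1 - 2 * (w.2 : ℝ), w.1), by fun_prop⟩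
  -- Contracts that back-and-forth loop, keeping its ends at `Y.pt`. Homotopy extension with values
  -- in the path space carries the contraction to all of `B`.
  let h : C(I, C(I, Y)) := ContinuousMap.curry
    ⟨fun w : I × I ↦ F (clampI ((1 - (w.1 : ℝ)) * (1 - |1 - 2 * (w.2 : ℝ)|)), B.pt), by fun_prop⟩
  have hφ (b : B.toPtSpace) (t : I) : φ b t = e (1 - 2 * (t : ℝ), b) := rfl
  have hh (s t : I) :
      h s t = F (clampI ((1 - (s : ℝ)) * (1 - |1 - 2 * (t : ℝ)|)), B.pt) := rfl
  obtain ⟨H, hH0, hHpt⟩ := B.hep (C(I, Y)) φ h (by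
    ext t
    rw [hh, hφ]
    have ht := t.2
    rcases le_total 0 (1 - 2 * (t : ℝ)) with h0 | h0
    · rw [hpos _ _ h0, abs_of_nonneg h0]
      congr 2
      have h1 : (1 - 2 * (t : ℝ)) = ((⟨1 - 2 * (t : ℝ), h0, by linarith [ht.1]⟩ : I) : ℝ) := rfl
      have h2 : (1 - ((0 : I) : ℝ)) * (1 - (1 - 2 * (t : ℝ))) =
        (σ (⟨1 - 2 * (t : ℝ), h0, by linarith [ht.1]⟩ : I) : I) := by
          simp [unitInterval.coe_symm_eq]
      rw [h2, clampI_coe]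
      conv_rhs => rw [h1, clampI_coe]
    · rw [hneg _ _ h0, abs_of_nonpos h0]
      congr 2
      have h1 : -(1 - 2 * (t : ℝ)) =
        ((⟨-(1 - 2 * (t : ℝ)), by linarith, by linarith [ht.2]⟩ : I) : ℝ) := rfl
      have h2 : (1 - ((0 : I) : ℝ)) * (1 - -(1 - 2 * (t : ℝ))) =
        (σ (⟨-(1 - 2 * (t : ℝ)), by linarith, by linarith [ht.2]⟩ : I) : I) := by
          simp [unitInterval.coe_symm_eq]
      rw [h2, clampI_coe]
      conv_rhs => rw [h1, clampI_coe])
  have hpt0 (s : I) : H (s, B.pt) 0 = Y.pt := by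
    rw [hHpt, hh]
    simp [hF0, f.map_pt]
  have hpt1 (s : I) : H (s, B.pt) 1 = Y.pt := by
    rw [hHpt, hh]
    norm_num [hF0, f.map_pt]
  have hpt2 (t : I) : H (1, B.pt) t = Y.pt := by
    rw [hHpt, hh]
    simp [hF0, f.map_pt]
  have h0 (b) : H (0, b) 0 = f.map b := by
    rw [hH0, hφ]
    simp [hpos, hF0]
  have h1 (b) : H (0, b) 1 = Y.pt := by
    rw [hH0, hφ]
    norm_num [hneg, hF0, f.map_pt]
  let f₀ : PtMap B Y := ⟨⟨fun b ↦ H (1, b) 0, by fun_prop⟩, hpt0 1⟩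
  let f₁ : PtMap B Y := ⟨⟨fun b ↦ H (1, b) 1, by fun_prop⟩, hpt1 1⟩
  -- Three sides of the extended square give a pointed homotopy: along `t = 0`, across `s = 1`, and
  -- back along `t = 1`. The base point stays fixed on all three.
  have e₀ : PtHomotopic f f₀ :=
    PtHomotopic.of_fun (fun w ↦ H w 0) (by fun_prop) h0 (fun _ ↦ rfl) hpt0
  have e₁ : PtHomotopic f₀ f₁ :=
    PtHomotopic.of_fun (fun w ↦ H (1, w.2) w.1) (by fun_prop) (fun _ ↦ rfl) (fun _ ↦ rfl) hpt2
  have e₂ : PtHomotopic (PtMap.const B Y) f₁ :=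
    PtHomotopic.of_fun (fun w ↦ H w 1) (by fun_prop) h1 (fun _ ↦ rfl) hpt1
  exact (e₀.trans e₁).trans e₂.symm

/-! ### Unreduced cofibres -/

section UCofibre

variable {X Z : PtSpace.{u}} (f : PtMap X Z)

/-- The unreduced mapping cone of `f : X → Z`, pointed by the vertex of the cone. -/
def uCofibre : PtSpace.{u} where
  carrier := Quot (EndRel (PtMap.const X point) f)
  pt := Quot.mk _ (Sum.inl PUnit.unit)

instance t2Space_uCofibre [T2Space X] [T2Space Z] : T2Space (uCofibre f) :=
  t2Space_quot_endRel

/-- The projection onto the unreduced mapping cone. -/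
def uCofibreMk (w : point.{u} ⊕ ((I × X) ⊕ Z)) : uCofibre f := Quot.mk _ w

theorem isQuotientMap_uCofibreMk : Topology.IsQuotientMap (uCofibreMk f) :=
  isQuotientMap_quot_mk

/-- The cone of the unreduced mapping cone. -/
def uCofibreCone : C(I × X, uCofibre f) :=
  ⟨fun q ↦ Quot.mk _ (Sum.inr (Sum.inl q)),
    continuous_quot_mk.comp (continuous_inr.comp continuous_inl)⟩

/-- The inclusion of the target into the unreduced mapping cone. -/
def toUCofibre : C(Z, uCofibre f) :=
  ⟨fun z ↦ Quot.mk _ (Sum.inr (Sum.inr z)),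
    continuous_quot_mk.comp (continuous_inr.comp continuous_inr)⟩

theorem uCofibreCone_zero (x : X) : uCofibreCone f (0, x) = (uCofibre f).pt :=
  Quot.sound (EndRel.left x)

theorem uCofibreCone_one (x : X) : uCofibreCone f (1, x) = toUCofibre f (f.map x) :=
  Quot.sound (EndRel.right x)

/-- The projection from the unreduced to the reduced mapping cone. -/
def uCofibreToCofibre : PtMap (uCofibre f) (cofibre f) where
  map :=
    { toFun := Quot.lift (Quot.mk _) (by
        rintro _ _ (x | x)
        · exact Quot.sound (CylRel.left x)
        · exact Quot.sound (CylRel.right x))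
      continuous_toFun := continuous_quot_lift _ continuous_quot_mk }
  map_pt := rfl

end UCofibre

/-- For a map `p` of well-pointed spaces, the reduced cofibre maps to the unreduced one, compatibly
up to free homotopy with the inclusions of the target. -/
theorem exists_cofibre_to_uCofibre {E B : WPSpace.{u}} (p : PtMap E B) :
    ∃ χ : PtMap (cofibre p) (uCofibre p), (toUCofibre p).Homotopic (χ.comp (toCofibre p)).map := by
  -- Slide the image of the base point along its cone line to the vertex, turning the inclusion of
  -- `B` into a pointed map `b`.
  obtain ⟨H, hH0, hHpt⟩ := B.hep (uCofibre p) (toUCofibre p)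
    ⟨fun t ↦ uCofibreCone p (σ t, E.pt), by fun_prop⟩ (by
      change uCofibreCone p (σ 0, E.pt) = _
      rw [unitInterval.symm_zero, uCofibreCone_one, p.map_pt])
  let b : PtMap B (uCofibre p) := ⟨⟨fun x ↦ H (1, x), by fun_prop⟩, by
    refine (hHpt 1).trans ?_
    change uCofibreCone p (σ 1, E.pt) = _
    rw [unitInterval.symm_one, uCofibreCone_zero]⟩
  have hb : (toUCofibre p).Homotopic b.map := ⟨⟨H, hH0, fun _ ↦ rfl⟩⟩
  have hc : (ContinuousMap.const E.toPtSpace (uCofibre p).pt).Homotopic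
      ((toUCofibre p).comp p.map) :=
    ⟨⟨uCofibreCone p, uCofibreCone_zero p, uCofibreCone_one p⟩⟩
  -- The cone contracts `b ∘ p` freely; well-pointedness of `E` makes the contraction pointed.
  have hbp : IsTrivial (b.comp p) := by
    refine isTrivial_of_homotopic_const (y := (uCofibre p).pt) (ContinuousMap.Homotopic.symm ?_)
    exact hc.trans (hb.comp (ContinuousMap.Homotopic.refl p.map))
  obtain ⟨χ, hχ⟩ := exists_extension_to_cofibre hbp
  exact ⟨χ, hχ ▸ hb⟩

/-! ### The pairing of unreduced cofibres -/

section ConePairing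

variable {X Z E B : PtSpace.{u}} (f : PtMap X Z) (p : PtMap E B)

/-- The pair `(x, y)` as a point of the product. -/
def prodMk {X Y : PtSpace.{u}} (x : X) (y : Y) : prod X Y :=
  CompactCoherentification.mk (X × Y) (x, y)

/-- The point of the homotopy pullback of `f × id` and `id × p` given by a constant path. -/
def constPathPoint :
    PtMap (prod X E) (hoPullback (prodMap f (PtMap.id B)) (prodMap (PtMap.id Z) p)) where
  map :=
    { toFun := fun w ↦ CompactCoherentification.mk _
        ⟨((prodMap (PtMap.id X) p).map w, ContinuousMap.const I ((prodMap f p).map w),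
          (prodMap f (PtMap.id E)).map w), rfl, rfl⟩
      continuous_toFun := by
        refine continuous_toK
          (Y := HoPullbackSet (prodMap f (PtMap.id B)) (prodMap (PtMap.id Z) p))
          (Continuous.subtype_mk ?_ _)
        have := ContinuousMap.continuous_const' (X := I) (Y := prod Z B)
        fun_prop }
  map_pt := by
    refine congrArg (CompactCoherentification.mk _) (Subtype.ext ?_)
    exact Prod.ext (prodMap (PtMap.id X) p).map_pt (Prod.ext
      (congrArg (ContinuousMap.const I) (prodMap f p).map_pt) (prodMap f (PtMap.id E)).map_pt)

/-- The join of `f × id` and `id × p`. -/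
abbrev extJoin : PtMap (join (prodMap f (PtMap.id B)) (prodMap (PtMap.id Z) p)) (prod Z B) :=
  joinMap (prodMap f (PtMap.id B)) (prodMap (PtMap.id Z) p)

/-- The reparametrization of the cone coordinate. -/
def coneParam (s : I) : I := clampI (2 * (s : ℝ))

/-- The join coordinate of a point in the product of two cones. -/
def joinParam (s t : I) : I := clampI (1 / 2 + (s : ℝ) - t)

@[fun_prop]
theorem continuous_coneParam : Continuous coneParam := by
  unfold coneParam
  fun_prop

@[fun_prop]
theorem continuous_joinParam : Continuous fun q : I × I ↦ joinParam q.1 q.2 := by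
  unfold joinParam
  fun_prop

@[simp] theorem coneParam_zero : coneParam 0 = 0 := by simp [coneParam]

@[simp] theorem coneParam_one : coneParam 1 = 1 := clampI_of_one_le (by norm_num)

theorem coneParam_eq_one {s : I} (h : 1 / 2 ≤ (s : ℝ)) : coneParam s = 1 :=
  clampI_of_one_le (by linarith)

theorem joinParam_one_left {t : I} (h : (t : ℝ) ≤ 1 / 2) : joinParam 1 t = 1 :=
  clampI_of_one_le (by simp only [Set.Icc.coe_one]; linarith)

theorem joinParam_one_right {s : I} (h : (s : ℝ) ≤ 1 / 2) : joinParam s 1 = 0 :=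
  clampI_of_nonpos (by simp only [Set.Icc.coe_one]; linarith)

/-- The left end of the join. -/
def extJoinInl (w : prod X B) : join (prodMap f (PtMap.id B)) (prodMap (PtMap.id Z) p) :=
  (hoPushoutInl _ _).map w

/-- The right end of the join. -/
def extJoinInr (w : prod Z E) : join (prodMap f (PtMap.id B)) (prodMap (PtMap.id Z) p) :=
  (hoPushoutInr _ _).map w

/-- The points of the join given by constant paths. -/
def extJoinCyl (r : I) (w : prod X E) :
    join (prodMap f (PtMap.id B)) (prodMap (PtMap.id Z) p) :=
  hoPushoutCyl _ _ (r, (constPathPoint f p).map w)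

/-- The pairing of the mapping cones of `f` and `p` in terms of their pieces. -/
def conePairingPieces : (point.{u} ⊕ ((I × X) ⊕ Z)) → (point.{u} ⊕ ((I × E) ⊕ B)) →
    uCofibre (extJoin f p) :=
  Sum.elim (fun _ _ ↦ (uCofibre _).pt) (Sum.elim
    (fun q ↦ Sum.elim (fun _ ↦ (uCofibre _).pt) (Sum.elim
      -- The join coordinate should be `1` on `s = 1` and `0` on `t = 1`, which conflict at the
      -- corner. Doubling the cone coordinates puts the whole square `s, t ≥ 1/2` at the base of the
      -- cone, where only `(f x, p e)` counts and the join coordinate is irrelevant.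
      (fun q' ↦ uCofibreCone _ (min (coneParam q.1) (coneParam q'.1),
        extJoinCyl f p (joinParam q.1 q'.1) (prodMk q.2 q'.2)))
      (fun b ↦ uCofibreCone _ (coneParam q.1,
        extJoinInl f p (prodMk q.2 b)))))
    (fun z ↦ Sum.elim (fun _ ↦ (uCofibre _).pt) (Sum.elim
      (fun q' ↦ uCofibreCone _ (coneParam q'.1,
        extJoinInr f p (prodMk z q'.2)))
      (fun b ↦ toUCofibre _ (prodMk z b)))))

theorem extJoin_inl (x : X) (b : B) :
    (extJoin f p).map (extJoinInl f p (prodMk x b)) =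
      prodMk (f.map x) b := rfl

theorem extJoin_inr (z : Z) (e : E) :
    (extJoin f p).map (extJoinInr f p (prodMk z e)) =
      prodMk z (p.map e) := rfl

theorem extJoin_cyl (r : I) (x : X) (e : E) :
    (extJoin f p).map (extJoinCyl f p r (prodMk x e)) =
      prodMk (f.map x) (p.map e) := rfl

theorem extJoinCyl_zero (x : X) (e : E) :
    extJoinCyl f p 0 (prodMk x e) =
      extJoinInl f p (prodMk x (p.map e)) :=
  hoPushoutCyl_zero _ _ _

theorem extJoinCyl_one (x : X) (e : E) :
    extJoinCyl f p 1 (prodMk x e) =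
      extJoinInr f p (prodMk (f.map x) e) :=
  hoPushoutCyl_one _ _ _

theorem conePairingPieces_left (x y) (w) (h : EndRel (PtMap.const X point) f x y) :
    conePairingPieces f p x w = conePairingPieces f p y w := by
  rcases h with x | x
  · rcases w with w | ⟨t, e⟩ | b
    · rfl
    · change uCofibreCone _ (min (coneParam 0) (coneParam t), _) = (uCofibre _).pt
      rw [coneParam_zero, min_eq_left unitInterval.nonneg', uCofibreCone_zero]
    · change uCofibreCone _ (coneParam 0, _) = (uCofibre _).pt
      rw [coneParam_zero, uCofibreCone_zero]
  · rcases w with w | ⟨t, e⟩ | b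
    · rfl
    · change uCofibreCone _ (min (coneParam 1) (coneParam t), extJoinCyl f p (joinParam 1 t) _) =
        uCofibreCone _ (coneParam t, extJoinInr f p _)
      rw [coneParam_one, min_eq_right unitInterval.le_one']
      rcases le_total (t : ℝ) (1 / 2) with ht | ht
      · rw [joinParam_one_left ht, extJoinCyl_one]
      · rw [coneParam_eq_one ht, uCofibreCone_one, uCofibreCone_one, extJoin_cyl, extJoin_inr]
    · change uCofibreCone _ (coneParam 1, extJoinInl f p _) = toUCofibre _ _
      rw [coneParam_one, uCofibreCone_one, extJoin_inl]

theorem conePairingPieces_right (w) (x y) (h : EndRel (PtMap.const E point) p x y) :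
    conePairingPieces f p w x = conePairingPieces f p w y := by
  rcases h with e | e
  · rcases w with w | ⟨s, x⟩ | z
    · rfl
    · change uCofibreCone _ (min (coneParam s) (coneParam 0), _) = (uCofibre _).pt
      rw [coneParam_zero, min_eq_right unitInterval.nonneg', uCofibreCone_zero]
    · change uCofibreCone _ (coneParam 0, _) = (uCofibre _).pt
      rw [coneParam_zero, uCofibreCone_zero]
  · rcases w with w | ⟨s, x⟩ | z
    · rfl
    · change uCofibreCone _ (min (coneParam s) (coneParam 1), extJoinCyl f p (joinParam s 1) _) =
        uCofibreCone _ (coneParam s, extJoinInl f p _)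
      rw [coneParam_one, min_eq_left unitInterval.le_one']
      rcases le_total (s : ℝ) (1 / 2) with hs | hs
      · rw [joinParam_one_right hs, extJoinCyl_zero]
      · rw [coneParam_eq_one hs, uCofibreCone_one, uCofibreCone_one, extJoin_cyl, extJoin_inl]
    · change uCofibreCone _ (coneParam 1, extJoinInr f p _) = toUCofibre _ _
      rw [coneParam_one, uCofibreCone_one, extJoin_inr]

/-- The function underlying the pairing of mapping cones. -/
def conePairingFun (w : uCofibre f × uCofibre p) : uCofibre (extJoin f p) :=
  Quot.lift₂ (conePairingPieces f p) (conePairingPieces_right f p)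
    (fun x y w h ↦ conePairingPieces_left f p x y w h) w.1 w.2

theorem continuous_conePairingPieces :
    Continuous fun w : CompactCoherentification
        ((point.{u} ⊕ ((I × X) ⊕ Z)) × (point.{u} ⊕ ((I × E) ⊕ B))) ↦
      conePairingPieces f p ((CompactCoherentification.mk
          ((point.{u} ⊕ ((I × X) ⊕ Z)) × (point.{u} ⊕ ((I × E) ⊕ B)))).symm w).1
        ((CompactCoherentification.mk
          ((point.{u} ⊕ ((I × X) ⊕ Z)) × (point.{u} ⊕ ((I × E) ⊕ B)))).symm w).2 := by
  have hsymm {P R : Type u} [TopologicalSpace P] [TopologicalSpace R] :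
      Continuous (CompactCoherentification.mk (P × R)).symm :=
    CompactCoherentification.continuous_mk_symm
  have hmk {K P R : Type u} [TopologicalSpace K] [CompactlyCoherentSpace K] [TopologicalSpace P]
      [TopologicalSpace R] {a : K → P} {b : K → R} (ha : Continuous a) (hb : Continuous b) :
      Continuous fun k ↦ CompactCoherentification.mk (P × R) (a k, b k) :=
    continuous_toK (Y := P × R) (ha.prodMk hb)
  have hinl : Continuous (extJoinInl f p) := (hoPushoutInl _ _).map.continuous
  have hinr : Continuous (extJoinInr f p) := (hoPushoutInr _ _).map.continuous
  have hcyl : Continuous fun w : I × prod X E ↦ extJoinCyl f p w.1 w.2 := by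
    have h1 := continuous_hoPushoutCyl
      (hoPullbackFst (prodMap f (PtMap.id B)) (prodMap (PtMap.id Z) p))
      (hoPullbackSnd (prodMap f (PtMap.id B)) (prodMap (PtMap.id Z) p))
    have h2 := (constPathPoint f p).map.continuous
    exact h1.comp (continuous_fst.prodMk (h2.comp continuous_snd))
  refine continuous_prod_sum (fun w ↦ conePairingPieces f p w.1 w.2) continuous_const ?_
  refine continuous_prod_sum (fun w ↦ conePairingPieces f p (Sum.inr w.1) w.2) ?_ ?_
  · refine continuous_prod_swap (fun w ↦ conePairingPieces f p (Sum.inr (Sum.inl w.1)) w.2) ?_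
    refine continuous_prod_sum (fun w ↦ conePairingPieces f p (Sum.inr (Sum.inl w.2)) w.1)
      continuous_const ?_
    refine continuous_prod_sum
      (fun w ↦ conePairingPieces f p (Sum.inr (Sum.inl w.2)) (Sum.inr w.1)) ?_ ?_
    · have h1 := hsymm (P := I × E) (R := I × X)
      have h2 : Continuous fun w ↦ prodMk
          ((CompactCoherentification.mk ((I × E) × I × X)).symm w).2.2
          ((CompactCoherentification.mk ((I × E) × I × X)).symm w).1.2 :=
        hmk (by fun_prop) (by fun_prop)
      exact (uCofibreCone (extJoin f p)).continuous.comp (f := fun w ↦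
        (min (coneParam ((CompactCoherentification.mk ((I × E) × I × X)).symm w).2.1)
          (coneParam ((CompactCoherentification.mk ((I × E) × I × X)).symm w).1.1),
        extJoinCyl f p (joinParam ((CompactCoherentification.mk ((I × E) × I × X)).symm w).2.1
          ((CompactCoherentification.mk ((I × E) × I × X)).symm w).1.1) (prodMk
          ((CompactCoherentification.mk ((I × E) × I × X)).symm w).2.2
          ((CompactCoherentification.mk ((I × E) × I × X)).symm w).1.2)))
        (.prodMk (by fun_prop) (hcyl.comp (.prodMk (by fun_prop) h2)))
    · have h1 := hsymm (P := B) (R := I × X)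
      exact (uCofibreCone (extJoin f p)).continuous.comp (f := fun w ↦
        (coneParam ((CompactCoherentification.mk (B × I × X)).symm w).2.1, extJoinInl f p (prodMk
          ((CompactCoherentification.mk (B × I × X)).symm w).2.2
          ((CompactCoherentification.mk (B × I × X)).symm w).1)))
        (.prodMk (by fun_prop) (hinl.comp (hmk (by fun_prop) (by fun_prop))))
  · refine continuous_prod_swap (fun w ↦ conePairingPieces f p (Sum.inr (Sum.inr w.1)) w.2) ?_
    refine continuous_prod_sum (fun w ↦ conePairingPieces f p (Sum.inr (Sum.inr w.2)) w.1)
      continuous_const ?_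
    refine continuous_prod_sum
      (fun w ↦ conePairingPieces f p (Sum.inr (Sum.inr w.2)) (Sum.inr w.1)) ?_ ?_
    · have h1 := hsymm (P := I × E) (R := Z)
      exact (uCofibreCone (extJoin f p)).continuous.comp (f := fun w ↦
        (coneParam ((CompactCoherentification.mk ((I × E) × Z)).symm w).1.1, extJoinInr f p (prodMk
          ((CompactCoherentification.mk ((I × E) × Z)).symm w).2
          ((CompactCoherentification.mk ((I × E) × Z)).symm w).1.2)))
        (.prodMk (by fun_prop) (hinr.comp (hmk (by fun_prop) (by fun_prop))))
    · have h1 := hsymm (P := B) (R := Z)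
      exact (toUCofibre (extJoin f p)).continuous.comp (hmk (by fun_prop) (by fun_prop))

/-- The pairing of the unreduced mapping cones of `f` and `p` with values in the mapping cone of
the join of `f × id` and `id × p`. -/
def conePairing [T2Space X] [T2Space Z] [T2Space E] [T2Space B] :
    PtMap (prod (uCofibre f) (uCofibre p)) (uCofibre (extJoin f p)) where
  map :=
    { toFun := fun w ↦ conePairingFun f p
        ((CompactCoherentification.mk (uCofibre f × uCofibre p)).symm w)
      continuous_toFun := continuous_of_quotient_prod (Y := uCofibre f) (Z := uCofibre p)
        (isQuotientMap_uCofibreMk f) (isQuotientMap_uCofibreMk p) (conePairingFun f p)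
        (continuous_conePairingPieces f p) }
  map_pt := rfl

theorem trivialOnWedge_conePairing [T2Space X] [T2Space Z] [T2Space E] [T2Space B] :
    TrivialOnWedge (conePairing f p) := by
  refine ⟨?_, ?_⟩
  · rintro ⟨w⟩
    rfl
  · rintro ⟨w | w | w⟩ <;> rfl

end ConePairing

/-- The iterated pairing of mapping cones. -/
def iteratedConePairing {E B : PtSpace.{u}} [T2Space E] [T2Space B] (p : PtMap E B) :
    (n : ℕ) → PtMap (power (uCofibre p) n) (uCofibre (sectionalFatWedge p n).2)
  | 0 => PtMap.id _
  | n + 1 => (conePairing (sectionalFatWedge p n).2 p).comp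
      (prodMap (iteratedConePairing p n) (PtMap.id _))

theorem iteratedConePairing_eq_pt {E B : PtSpace.{u}} [T2Space E] [T2Space B] (p : PtMap E B)
    (n : ℕ) {a : power (uCofibre p) n} (ha : a ∈ fatWedge (uCofibre p) n) :
    (iteratedConePairing p n).map a = (uCofibre (sectionalFatWedge p n).2).pt := by
  induction n with
  | zero => exact ha
  | succ n ih =>
    have h := trivialOnWedge_conePairing (sectionalFatWedge p n).2 p
    rcases ha with ha | ha
    · exact (congrArg (fun w ↦ (conePairing (sectionalFatWedge p n).2 p).map
        (prodMk w (prodSnd (power (uCofibre p) n) _ |>.map a))) (ih ha)).trans (h.1 _)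
    · exact (congrArg (fun w ↦ (conePairing (sectionalFatWedge p n).2 p).map
        (prodMk ((iteratedConePairing p n).map (prodFst (power (uCofibre p) n) _ |>.map a)) w))
          ha).trans (h.2 _)

/-- Stated on points because the inclusion of `B` into the unreduced cone is not a pointed map. -/
theorem iteratedConePairing_diag {E B : PtSpace.{u}} [T2Space E] [T2Space B] (p : PtMap E B)
    (n : ℕ) (b : B) : (iteratedConePairing p n).map ((diag (uCofibre p) n).map (toUCofibre p b)) =
      toUCofibre _ ((diag B n).map b) := by
  induction n with
  | zero => rfl
  | succ n ih =>
    exact congrArg (fun w ↦ (conePairing (sectionalFatWedge p n).2 p).map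
      (prodMk w (toUCofibre p b))) ih

theorem powerMap_mem_fatWedge {B Q : PtSpace.{u}} (u : PtMap B Q) (n : ℕ) {a : power B n}
    (ha : a ∈ fatWedge B n) : (powerMap u n).map a ∈ fatWedge Q n := by
  induction n with
  | zero => exact (congrArg u.map ha).trans u.map_pt
  | succ n ih =>
    rcases ha with ha | ha
    · exact Or.inl (ih ha)
    · exact Or.inr ((congrArg u.map ha).trans u.map_pt)

/-- A map out of a power which is trivial on the fat wedge factors through the smash power. -/
theorem exists_smashPower_factorization {B V : PtSpace.{u}} {n : ℕ} (k : PtMap (power B n) V)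
    (hk : ∀ a ∈ fatWedge B n, k.map a = V.pt) :
    ∃ r : PtMap (smashPower B n) V, r.comp (smashQuot B n) = k :=
  ⟨⟨⟨Quot.lift k.map fun a b h ↦ (hk a h.1).trans (hk b h.2).symm,
    continuous_quot_lift _ k.map.continuous⟩, k.map_pt⟩, rfl⟩

/-- A map killing the fat wedge factors through the smash power, so on the diagonal it factors
through the reduced diagonal. -/
theorem isTrivial_of_wcatLE {B Q V : PtSpace.{u}} {u : PtMap B Q} {n : ℕ} (h : WcatLE u n)
    (k : PtMap (power Q n) V) (hk : ∀ a ∈ fatWedge Q n, k.map a = V.pt) :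
    IsTrivial ((k.comp (diag Q n)).comp u) := by
  obtain ⟨r, rfl⟩ := exists_smashPower_factorization k hk
  exact h.postcomp r

/-- If the inclusion `B → C_p` has weak category at most `n`, then `p` has weak sectional category
at most `n`. -/
theorem isTrivial_toCofibre_diag {E B : WPSpace.{u}} {p : PtMap E B} {n : ℕ}
    (h : WcatLE (toCofibre p) n) :
    IsTrivial ((toCofibre (sectionalFatWedge p n).2).comp (diag B n)) := by
  have : T2Space E.carrier := E.t2
  have : T2Space B.carrier := B.t2
  obtain ⟨χ, hχ⟩ := exists_cofibre_to_uCofibre p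
  let k := iteratedConePairing p n
  have h1 := isTrivial_of_wcatLE h (k.comp (powerMap χ n)) fun a ha ↦
    iteratedConePairing_eq_pt p n (powerMap_mem_fatWedge χ n ha)
  have h2 : ((k.comp (powerMap χ n)).comp (diag (cofibre p) n)).comp (toCofibre p) =
      (k.comp (diag (uCofibre p) n)).comp (χ.comp (toCofibre p)) :=
    PtMap.ext fun b ↦ congrArg k.map (powerMap_diag χ n _)
  rw [h2] at h1
  let c := uCofibreToCofibre (sectionalFatWedge p n).2
  obtain ⟨H⟩ := h1.postcomp c
  -- Since `χ` matches the inclusions of `B` only up to free homotopy, a free null-homotopy is what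
  -- results; it suffices because `B` is well-pointed.
  refine isTrivial_of_homotopic_const (y := (cofibre (sectionalFatWedge p n).2).pt) ?_
  have h3 := (ContinuousMap.Homotopic.refl (c.comp (k.comp (diag (uCofibre p) n))).map).comp hχ
  have h4 : (c.comp (k.comp (diag (uCofibre p) n))).map.comp (toUCofibre p) =
      ((toCofibre (sectionalFatWedge p n).2).comp (diag B n)).map :=
    ContinuousMap.ext fun b ↦ congrArg c.map (iteratedConePairing_diag p n b)
  rw [h4] at h3
  exact h3.trans ⟨H.toHomotopy⟩

/-! ### Bounds for the numerical invariants -/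

theorem iInf_eq_top_or_exists (P : ℕ → Prop) :
    (⨅ (n : ℕ) (_ : P n), (n : ℕ∞)) = ⊤ ∨
      ∃ n, P n ∧ (⨅ (n : ℕ) (_ : P n), (n : ℕ∞)) = n := by
  classical
  by_cases h : ∃ n, P n
  · refine Or.inr ⟨Nat.find h, Nat.find_spec h, le_antisymm (iInf₂_le _ (Nat.find_spec h)) ?_⟩
    exact le_iInf₂ fun n hn ↦ Nat.cast_le.mpr (Nat.find_min' h hn)
  · exact Or.inl (iInf₂_eq_top.mpr fun n hn ↦ absurd ⟨n, hn⟩ h)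

theorem wsecat_eq_top_or_exists {E B : PtSpace.{u}} (p : PtMap E B) : wsecat p = ⊤ ∨
    ∃ n : ℕ, IsTrivial ((toCofibre (sectionalFatWedge p n).2).comp (diag B n)) ∧ wsecat p = n :=
  iInf_eq_top_or_exists _

theorem wcat_eq_top_or_exists (B : PtSpace.{u}) :
    wcat B = ⊤ ∨ ∃ n : ℕ, WcatLE (PtMap.id B) n ∧ wcat B = n :=
  iInf_eq_top_or_exists fun n ↦ IsTrivial (reducedDiag B n)

theorem wcat_le {B : PtSpace.{u}} {n : ℕ} (h : WcatLE (PtMap.id B) n) : wcat B ≤ n :=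
  iInf₂_le (f := fun (n : ℕ) (_ : IsTrivial (reducedDiag B n)) ↦ (n : ℕ∞)) n h

theorem wsecat_le {E B : WPSpace.{u}} {p : PtMap E B} {n : ℕ} (h : WcatLE (toCofibre p) n) :
    wsecat p ≤ n :=
  iInf₂_le (f := fun (n : ℕ) (_ : IsTrivial ((toCofibre (sectionalFatWedge p n).2).comp
    (diag B n))) ↦ (n : ℕ∞)) n (isTrivial_toCofibre_diag h)

theorem WcatLE.postcomp {B Q R : PtSpace.{u}} {u : PtMap B Q} {n : ℕ} (h : WcatLE u n)
    (k : PtMap Q R) : WcatLE (k.comp u) n := by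
  have h1 := isTrivial_of_wcatLE h ((smashQuot R n).comp (powerMap k n)) fun a ha ↦
    smashQuot_eq_pt (powerMap_mem_fatWedge k n ha)
  have h2 : (((smashQuot R n).comp (powerMap k n)).comp (diag Q n)).comp u =
      (reducedDiag R n).comp (k.comp u) :=
    PtMap.ext fun b ↦ congrArg (smashQuot R n).map (powerMap_diag k n _)
  rwa [h2] at h1

theorem wcatLE_of_point {Q : PtSpace.{u}} (u : PtMap point Q) : WcatLE u 0 := by
  have : (reducedDiag Q 0).comp u = PtMap.const _ _ :=
    PtMap.ext fun _ ↦ ((reducedDiag Q 0).comp u).map_pt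
  rw [WcatLE, this]
  exact PtHomotopic.refl _

/-- The composite of a map with the inclusion of its target into the cofibre is trivial. -/
theorem isTrivial_toCofibre_comp {X Y : PtSpace.{u}} (f : PtMap X Y) :
    IsTrivial ((toCofibre f).comp f) := by
  have h : PtHomotopic ((hoPushoutInl (PtMap.const X point) f).comp (PtMap.const X point))
    ((toCofibre f).comp f) := ⟨hoPushoutHomotopy (PtMap.const X point) f⟩
  rw [PtMap.comp_const] at h
  exact h.symm

end WSecat

end

open WSecat in
theorem mainTheorem2 :
    (∀ (A B C D A' B' C' D' : WPSpace.{u})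
      (g : PtMap A B) (f : PtMap A C) (i : PtMap B D) (j : PtMap C D)
      (g' : PtMap A' B') (f' : PtMap A' C') (i' : PtMap B' D') (j' : PtMap C' D')
      (α : PtMap A' A) (β : PtMap B' B) (γ : PtMap C' C) (δ : PtMap D' D)
      (H : PtHomotopy (i.comp g) (j.comp f)) (H' : PtHomotopy (i'.comp g') (j'.comp f'))
      (K : PtHomotopy (β.comp g') (g.comp α)) (L : PtHomotopy (f.comp α) (γ.comp f')),
      IsHoPushout H → IsHoPushout H' → IsInducedMap H' H K L δ →
        wsecat δ ≤ wsecat β + wsecat γ + 1) ∧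
    (∀ (A B C D : WPSpace.{u})
      (g : PtMap A B) (f : PtMap A C) (i : PtMap B D) (j : PtMap C D)
      (H : PtHomotopy (i.comp g) (j.comp f)),
      IsHoPushout H → wcat D ≤ wcat B + wcat C + 1) ∧
    (∀ (E B C X : WPSpace.{u}) (p : PtMap E B) (j : PtMap B C) (f : PtMap X B),
      IsCofibreSequence p j → wsecat (j.comp f) ≤ wsecat f + 1) ∧
    (∀ (E B C : WPSpace.{u}) (p : PtMap E B) (j : PtMap B C),
      IsCofibreSequence p j → wcat C ≤ wsecat p + 1) := by
  refine ⟨?_, ?_, ?_, ?_⟩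
  · intro A B C D A' B' C' D' g f i j g' f' i' j' α β γ δ H H' K L hH _ hδ
    have : T2Space D.carrier := D.t2
    have : T2Space D'.carrier := D'.t2
    obtain h | ⟨n, hn, hn'⟩ := wsecat_eq_top_or_exists β
    · simp [h]
    obtain h | ⟨m, hm, hm'⟩ := wsecat_eq_top_or_exists γ
    · simp [h]
    -- Restricting the comparison of `δ` to the two ends of the double mapping cylinder of the top
    -- row.
    have hi : PtHomotopic (δ.comp i') (i.comp β) := hδ.precomp (hoPushoutInl g' f')
    have hj : PtHomotopic (δ.comp j') (j.comp γ) := hδ.precomp (hoPushoutInr g' f')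
    have hc := isTrivial_toCofibre_comp δ
    have hβ : IsTrivial (((toCofibre δ).comp i).comp β) :=
      (hc.precomp i').congr (hi.postcomp (toCofibre δ))
    have hγ : IsTrivial (((toCofibre δ).comp j).comp γ) :=
      (hc.precomp j').congr (hj.postcomp (toCofibre δ))
    have key := WcatLE.of_isHoPushout hH (.of_isTrivial_comp hn hβ) (.of_isTrivial_comp hm hγ)
    rw [hn', hm']
    exact_mod_cast wsecat_le key
  · intro A B C D g f i j H hH
    have : T2Space D.carrier := D.t2
    obtain h | ⟨n, hn, hn'⟩ := wcat_eq_top_or_exists B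
    · simp [h]
    obtain h | ⟨m, hm, hm'⟩ := wcat_eq_top_or_exists C
    · simp [h]
    have key := WcatLE.of_isHoPushout (u := PtMap.id D.toPtSpace) hH (hn.postcomp i)
      (hm.postcomp j)
    rw [hn', hm']
    exact_mod_cast wcat_le key
  · rintro E B C X p j f ⟨H, hH⟩
    have : T2Space C.carrier := C.t2
    have : T2Space X.carrier := X.t2
    obtain h | ⟨n, hn, hn'⟩ := wsecat_eq_top_or_exists f
    · simp [h]
    -- The cone vertex is the other leg and contributes level `0`, leaving `0 + n + 1`.
    have key := WcatLE.of_isHoPushout (u := toCofibre (j.comp f)) hH (wcatLE_of_point _)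
      (.of_isTrivial_comp hn (isTrivial_toCofibre_comp (j.comp f)))
    rw [zero_add] at key
    rw [hn']
    exact_mod_cast wsecat_le key
  · rintro E B C p j ⟨H, hH⟩
    have : T2Space C.carrier := C.t2
    obtain h | ⟨n, hn, hn'⟩ := wsecat_eq_top_or_exists p
    · simp [h]
    have hjp : IsTrivial (j.comp p) := by
      have h1 : PtHomotopic ((PtMap.const point C).comp (PtMap.const E point)) (j.comp p) := ⟨H⟩
      exact h1.symm
    have key := WcatLE.of_isHoPushout (u := PtMap.id C.toPtSpace) hH (wcatLE_of_point _)
      (.of_isTrivial_comp hn hjp)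
    rw [zero_add] at key
    rw [hn']
    exact_mod_cast wcat_le key
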